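/- For a word $w$ with pairwise distinct letters in $\{1,2,\dots\}$ define $S(w)$ recursively by $S(w)=w$ if $w$ is empty, and $S(LmR)=S(L)S(R)m$ if $m$ is the greatest letter of $w=LmR$. View a permutation $\pi$ of $\{1,\dots,n\}$ as the word $\pi_1\pi_2\dots\pi_n$. We say that $\pi$ needs exactly $k$ stack-sorting passes if $k$ is the smallest $j\ge 0$ with $S^j(\pi)=12\dots n$. In a pattern, $\ast$ stands for an arbitrary word (possibly empty) and $?$ for an arbitrary single letter. Theorem. For all $n\ge 6$, a permutation $\pi$ of $\{1,\dots,n\}$ needs exactly $n-3$ stack-sorting passes if and only if it has one of the following forms. 1. $\pi_n=n$ and $\pi$ is of the form (a) $\ast(n-1)\,2\,n$; (b) $\ast(n-1)\,?\,1\,n$; (c) $\ast(n-1)\,1\,?\,n$; (d) $\ast(n-1)\ast(n-3)\ast(n-2)\,1\,n$; (e) $\ast(n-2)\,1\,(n-1)\,n$. 2. $\pi_{n-1}=n$ and $\pi$ is of the form (a) $\ast\, n\,3$; (b) $\ast(n-1)\,1\,n\,k$ with $k>3$; (c) $\ast(n-2)\,1\,n\,(n-1)$. 3. $\pi_{n-2}=n$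 and $\pi$ is of the form (a) $\ast\, n\,2\,k$ with $k\ne 1$; (b) $\ast\, n\,k\,2$ with $k\neq 1$. 4. $\pi_{n-3}=n$ and $\pi$ is of the form (a) $\ast\, n\,?\,?\,1$, but not $\ast\, n\,(n-2)(n-1)\,1$; (b) $\ast\, n\,?\,1\,?$; (c) $\ast\, n\,1\,?\,?$; (d) $\ast\, n\,(n-2)(n-1)\,2$. 5. $\pi_{n-i}=n$ for some $i>3$ and $\pi$ is of the form (a) $\ast\, n\,A\,(n-2)\,B\,(n-1)\,2$, where the words $A$ and $B$ are not both empty; (b) $\ast\, n\ast(n-3)\ast(n-1)(n-2)\,1$; (c) $\ast\, n\ast(n-1)\ast(n-3)\ast(n-2)\,1$; (d) $\ast(n-1)\ast n\ast(n-3)\ast(n-4)\ast(n-2)\,1$ or $\ast(n-1)\ast n\ast(n-4)\ast(n-3)\ast(n-2)\,1$; (e) $\ast\, n\ast(n-2)\ast(n-1)\,1\,?$ or $\ast\, n\ast(n-2)\ast(n-1)\,?\,1$; (f) $\ast\, n\ast(n-3)\ast(n-1)\,1\,(n-2)$; (g) $\ast\, n\ast(n-3)\ast(n-2)\,1\,(n-1)$;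 (h) $\ast(n-2)\ast n\ast(n-3)\ast(n-4)\ast(n-1)\,1$ or $\ast(n-2)\ast n\ast(n-4)\ast(n-3)\ast(n-1)\,1$. The number of these permutations is $$\frac{(n-4)!}{3}\left(47\binom{n-6}{2}+194\binom{n-6}{1}+297\right)=\frac{(47n^2-223n+240)\,(n-4)!}{6}.$$ -/

import Mathlib

namespace StackSorting

/-- The stack sorting operator on words of natural numbers: the empty word is fixed, and
if `m` is the greatest letter of a nonempty word `L m R`, then `S (L m R) = S(L) S(R) m`. -/
def stackSort (w : List ℕ) : List ℕ :=
  match h : w.max? with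
  | none => []
  | some m =>
    stackSort (w.takeWhile (· ≠ m)) ++ stackSort ((w.dropWhile (· ≠ m)).tail) ++ [m]
termination_by w.length
decreasing_by
  · have hm : m ∈ w := List.max?_mem h
    have hsplit := congrArg List.length (List.takeWhile_append_dropWhile (p := (· ≠ m)) (l := w))
    have hne : w.dropWhile (· ≠ m) ≠ [] := by
      simpa [List.dropWhile_eq_nil_iff] using hm
    have := List.length_pos_iff.mpr hne
    simp only [List.length_append] at hsplit
    omega
  · have hm : m ∈ w := List.max?_mem h
    have hsplit := congrArg List.length (List.takeWhile_append_dropWhile (p := (· ≠ m)) (l := w))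
    have hne : w.dropWhile (· ≠ m) ≠ [] := by
      simpa [List.dropWhile_eq_nil_iff] using hm
    have := List.length_pos_iff.mpr hne
    simp only [List.length_append] at hsplit
    simp only [List.length_tail]
    omega

theorem stackSort_nil : stackSort [] = [] := by
  rw [stackSort.eq_def]; rfl

/-- The defining recursion `S (L m R) = S(L) S(R) m`. -/
theorem stackSort_append_cons (L R : List ℕ) (m : ℕ) (hL : ∀ x ∈ L, x < m)
    (hR : ∀ x ∈ R, x < m) :
    stackSort (L ++ m :: R) = stackSort L ++ stackSort R ++ [m] := by
  have hmax : (L ++ m :: R).max? = some m := by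
    rw [List.max?_eq_some_iff]
    refine ⟨by simp, fun b hb => ?_⟩
    rcases List.mem_append.mp hb with h | h
    · exact (hL b h).le
    · rcases List.mem_cons.mp h with h | h
      · exact h.le
      · exact (hR b h).le
  have hne : ∀ x ∈ L, decide (x ≠ m) = true := fun x hx => by
    simpa using (hL x hx).ne
  have ht : (L ++ m :: R).takeWhile (· ≠ m) = L := by
    rw [List.takeWhile_append_of_pos hne]; simp
  have hd : (L ++ m :: R).dropWhile (· ≠ m) = m :: R := by
    rw [List.dropWhile_append_of_pos hne]; simp
  rw [stackSort.eq_def]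
  split
  · next h => rw [hmax] at h; cases h
  · next k h =>
    rw [hmax] at h
    cases h
    rw [ht, hd]; rfl

/-- The identity permutation `1 2 … n` as a word. -/
def idWord (n : ℕ) : List ℕ := List.range' 1 n

/-- The permutations of `{1, …, n}`, viewed as words. -/
def perms (n : ℕ) : Set (List ℕ) := {w | w.Perm (idWord n)}

/-- The permutations of `{1, …, n}` whose stack sorting complexity is exactly `k`: the
smallest `j` such that `j` passes through the stack sort the permutation is `k`. -/
def exactly (n k : ℕ) : Set (List ℕ) :=
  {w | w ∈ perms n ∧ IsLeast {j : ℕ | stackSort^[j] w = idWord n} k}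

/-- The symbols of a glob pattern. -/
inductive Glob : Type
  /-- the asterisk: any word, possibly empty -/
  | star : Glob
  /-- the question mark: any single letter -/
  | any : Glob
  /-- a fixed letter -/
  | lit : ℕ → Glob

/-- The words that a single glob symbol stands for. -/
def Glob.words : Glob → Set (List ℕ)
  | .star => Set.univ
  | .any => {w | ∃ a, w = [a]}
  | .lit a => {[a]}

/-- The set of all words of the form given by a glob pattern. -/
def glob : List Glob → Set (List ℕ)
  | [] => {[]}
  | s :: p => {w | ∃ u ∈ s.words, ∃ v ∈ glob p, w = u ++ v}

/-- `entryIs w i a` says that the `i`-th letter of `w`, counted from `1`, exists and is `a`. -/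
def entryIs (w : List ℕ) (i a : ℕ) : Prop := 1 ≤ i ∧ w[i - 1]? = some a

open Glob

/-- The types with `π_n = n`. -/
def type1 (n : ℕ) : Set (List ℕ) :=
  {w | entryIs w n n} ∩
    ( -- 1(a)
     glob [star, lit (n - 1), lit 2, lit n] ∪
     -- 1(b)
     glob [star, lit (n - 1), any, lit 1, lit n] ∪
     -- 1(c)
     glob [star, lit (n - 1), lit 1, any, lit n] ∪
     -- 1(d)
     glob [star, lit (n - 1), star, lit (n - 3), star, lit (n - 2), lit 1, lit n] ∪
     -- 1(e)
     glob [star, lit (n - 2), lit 1, lit (n - 1), lit n])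

/-- The types with `π_{n-1} = n`. -/
def type2 (n : ℕ) : Set (List ℕ) :=
  {w | entryIs w (n - 1) n} ∩
    ( -- 2(a)
     glob [star, lit n, lit 3] ∪
     -- 2(b), where the last letter is greater than 3
     {w | ∃ k, 3 < k ∧ w ∈ glob [star, lit (n - 1), lit 1, lit n, lit k]} ∪
     -- 2(c)
     glob [star, lit (n - 2), lit 1, lit n, lit (n - 1)])

/-- The types with `π_{n-2} = n`. -/
def type3 (n : ℕ) : Set (List ℕ) :=
  {w | entryIs w (n - 2) n} ∩
    ( -- 3(a), where the last letter is not 1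
     {w | ∃ k, k ≠ 1 ∧ w ∈ glob [star, lit n, lit 2, lit k]} ∪
     -- 3(b), where the letter before the last is not 1
     {w | ∃ k, k ≠ 1 ∧ w ∈ glob [star, lit n, lit k, lit 2]})

/-- The types with `π_{n-3} = n`. -/
def type4 (n : ℕ) : Set (List ℕ) :=
  {w | entryIs w (n - 3) n} ∩
    ( -- 4(a)
     (glob [star, lit n, any, any, lit 1] \
       glob [star, lit n, lit (n - 2), lit (n - 1), lit 1]) ∪
     -- 4(b)
     glob [star, lit n, any, lit 1, any] ∪
     -- 4(c)
     glob [star, lit n, lit 1, any, any] ∪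
     -- 4(d)
     glob [star, lit n, lit (n - 2), lit (n - 1), lit 2])

/-- The types with `π_{n-i} = n` for some `i > 3`. -/
def type5 (n : ℕ) : Set (List ℕ) :=
  {w | ∃ i, 3 < i ∧ entryIs w (n - i) n} ∩
    ( -- 5(a)
     {w | ∃ C A B : List ℕ, w = C ++ [n] ++ A ++ [n - 2] ++ B ++ [n - 1, 2] ∧
        (A ≠ [] ∨ B ≠ [])} ∪
     -- 5(b)
     glob [star, lit n, star, lit (n - 3), star, lit (n - 1), lit (n - 2), lit 1] ∪
     -- 5(c)
     glob [star, lit n, star, lit (n - 1), star, lit (n - 3), star, lit (n - 2), lit 1] ∪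
     -- 5(d)
     (glob [star, lit (n - 1), star, lit n, star, lit (n - 3), star, lit (n - 4), star,
        lit (n - 2), lit 1] ∪
      glob [star, lit (n - 1), star, lit n, star, lit (n - 4), star, lit (n - 3), star,
        lit (n - 2), lit 1]) ∪
     -- 5(e)
     (glob [star, lit n, star, lit (n - 2), star, lit (n - 1), lit 1, any] ∪
      glob [star, lit n, star, lit (n - 2), star, lit (n - 1), any, lit 1]) ∪
     -- 5(f)
     glob [star, lit n, star, lit (n - 3), star, lit (n - 1), lit 1, lit (n - 2)] ∪
     -- 5(g)
     glob [star, lit n, star, lit (n - 3), star, lit (n - 2), lit 1, lit (n - 1)] ∪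
     -- 5(h)
     (glob [star, lit (n - 2), star, lit n, star, lit (n - 3), star, lit (n - 4), star,
        lit (n - 1), lit 1] ∪
      glob [star, lit (n - 2), star, lit n, star, lit (n - 4), star, lit (n - 3), star,
        lit (n - 1), lit 1]))

end StackSorting

/-!
In a stack sorting pass, the letters that are written before a letter `a` enters the stack depend
only on the letters that precede `a`. Let `inversionsAt a w` be the word of the letters that are
greater than `a` and precede it. A pass replaces this word by `popped (inversionsAt a w)`, where
`popped (L m R) = S(L) popped(R)` if `m` is the greatest letter; in other words, `popped` is a pass
without the letters that are still on the stack when the input ends (`inversionsAt_stackSort`).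
Hence `S^k(w)` is sorted if and only if `popped^k` empties the words of inversions at all letters,
and the letters can be treated separately.

Every application of `popped` to a nonempty word removes its right-to-left maxima, at least one
letter. There are at most `n - a` inversions at `a`, so whether a permutation needs exactly `n - 3`
passes is decided at `a = 1, 2, 3`, by words whose number of letters exceeds the number of passes
that empty them by at most `2`. This excess is bounded by the slack in `Slow s w`: emptying `w`
takes at least `|w| - s` applications. Slack `0` means that the greatest letter comes last
(`slow_zero_iff`). A word `L m R` can afford only few right-to-left maxima in `R`, and after one
application of `popped` it is a concatenation of outputs of passes, each of which ends in its
greatest letter. So slack `1` and `2` can be described by the places of the three and five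
greatest letters (`slow_one_iff`, `slow_two_iff`).

Together these facts describe the permutations by inequalities between the places of
`n, …, n - 4, 1, 2, 3` (`mem_exactly_iff_shape`). So do the patterns (`mem_types_iff`), because
every asterisk in them is followed by a fixed letter, and the two descriptions agree by linear
arithmetic (`lateShape_and_not_laterShape_iff`).

For the number of permutations, words are identified with permutations of `Fin n`, which send
letters to places. Prescribing the places of `k` letters leaves `(n - k)!` permutations, and
prescribing in addition the order of the places of `t` other letters divides this by `t!`
(`count_eq_of_iff`). All the types are disjoint unions of sets of this kind and of differences of
such sets.
-/

namespace StackSorting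

/-! ### A stack sorting pass and the inversions at a letter -/

/-- Induction along the decomposition `w = L m R` at the greatest letter `m`. -/
theorem split_induction {motive : ∀ w : List ℕ, w.Nodup → Prop} (nil : motive [] List.nodup_nil)
    (split : ∀ L m R, ∀ h : (L ++ m :: R).Nodup, (∀ x ∈ L, x < m) → (∀ x ∈ R, x < m) →
      motive L h.of_append_left → motive R h.of_append_right.of_cons → motive (L ++ m :: R) h) :
    ∀ (w : List ℕ) (hw : w.Nodup), motive w hw := by
  intro w
  induction hk : w.length using Nat.strong_induction_on generalizing w with
  | _ k ih =>
    intro hw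
    rcases hm : w.max? with _ | m
    · rw [List.max?_eq_none_iff] at hm
      subst hm
      exact nil
    · obtain ⟨hmem, hle⟩ := List.max?_eq_some_iff.1 hm
      obtain ⟨L, R, rfl⟩ := List.append_of_mem hmem
      have hnd := hw
      rw [List.nodup_append, List.nodup_cons] at hw
      obtain ⟨hL, ⟨hmR, hR⟩, hd⟩ := hw
      simp only [List.length_append, List.length_cons] at hk
      refine split L m R hnd (fun x hx => ?_) (fun x hx => ?_)
        (ih L.length (by omega) L rfl hL) (ih R.length (by omega) R rfl hR)
      · exact lt_of_le_of_ne (hle x (by simp [hx])) (hd x hx m (by simp))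
      · exact lt_of_le_of_ne (hle x (by simp [hx])) (fun h => hmR (h ▸ hx))

theorem exists_split {w : List ℕ} (hw : w.Nodup) (hne : w ≠ []) :
    ∃ L m R, w = L ++ m :: R ∧ (∀ x ∈ L, x < m) ∧ (∀ x ∈ R, x < m) := by
  induction w, hw using split_induction with
  | nil => exact absurd rfl hne
  | split L m R _ hL hR => exact ⟨L, m, R, rfl, hL, hR⟩

theorem stackSort_perm {w : List ℕ} (hw : w.Nodup) : (stackSort w).Perm w := by
  induction w, hw using split_induction with
  | nil => rw [stackSort_nil]
  | split L m R _ hL hR ihL ihR =>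
    rw [stackSort_append_cons L R m hL hR, List.append_assoc]
    refine ihL.append ((ihR.append_right [m]).trans ?_)
    exact List.perm_append_comm

theorem nodup_stackSort {w : List ℕ} (hw : w.Nodup) : (stackSort w).Nodup :=
  (stackSort_perm hw).nodup_iff.2 hw

theorem mem_stackSort {w : List ℕ} (hw : w.Nodup) {x : ℕ} : x ∈ stackSort w ↔ x ∈ w :=
  (stackSort_perm hw).mem_iff

theorem length_stackSort {w : List ℕ} (hw : w.Nodup) : (stackSort w).length = w.length :=
  (stackSort_perm hw).length_eq

/-- Deleting the small letters commutes with a stack sorting pass. -/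
theorem stackSort_filter {w : List ℕ} (hw : w.Nodup) (a : ℕ) :
    (stackSort w).filter (a < ·) = stackSort (w.filter (a < ·)) := by
  induction w, hw using split_induction with
  | nil => simp [stackSort_nil]
  | split L m R _ hL hR ihL ihR =>
    rw [stackSort_append_cons L R m hL hR]
    by_cases ham : a < m
    · rw [List.filter_append (l₁ := L), List.filter_cons_of_pos (by simpa using ham),
        stackSort_append_cons]
      · simp [ihL, ihR, ham]
      · intro x hx; exact hL x (List.mem_filter.1 hx).1
      · intro x hx; exact hR x (List.mem_filter.1 hx).1
    · have h1 : L.filter (a < ·) = [] := by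
        simp only [List.filter_eq_nil_iff, decide_eq_true_eq]
        intro x hx; have := hL x hx; omega
      have h2 : R.filter (a < ·) = [] := by
        simp only [List.filter_eq_nil_iff, decide_eq_true_eq]
        intro x hx; have := hR x hx; omega
      rw [h1] at ihL
      rw [h2] at ihR
      simp [h1, h2, ihL, ihR, ham, stackSort_nil]

/-- The part of the output of a stack sorting pass that is written before the input `w` is
exhausted: the letters left on the stack at that moment, which are the right-to-left maxima
of `w`, are missing from it. -/
def popped (w : List ℕ) : List ℕ :=
  match h : w.max? with
  | none => []
  | some m =>
    stackSort (w.takeWhile (· ≠ m)) ++ popped ((w.dropWhile (· ≠ m)).tail)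
termination_by w.length
decreasing_by
  have hm : m ∈ w := List.max?_mem h
  have hsplit := congrArg List.length (List.takeWhile_append_dropWhile (p := (· ≠ m)) (l := w))
  have hne : w.dropWhile (· ≠ m) ≠ [] := by
    simpa [List.dropWhile_eq_nil_iff] using hm
  have := List.length_pos_iff.mpr hne
  simp only [List.length_append] at hsplit
  simp only [List.length_tail]
  omega

theorem popped_nil : popped [] = [] := by
  rw [popped.eq_def]; rfl

theorem popped_append_cons (L R : List ℕ) (m : ℕ) (hL : ∀ x ∈ L, x < m)
    (hR : ∀ x ∈ R, x < m) :
    popped (L ++ m :: R) = stackSort L ++ popped R := by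
  have hmax : (L ++ m :: R).max? = some m := by
    rw [List.max?_eq_some_iff]
    refine ⟨by simp, fun b hb => ?_⟩
    rcases List.mem_append.mp hb with h | h
    · exact (hL b h).le
    · rcases List.mem_cons.mp h with h | h
      · exact h.le
      · exact (hR b h).le
  have hne : ∀ x ∈ L, decide (x ≠ m) = true := fun x hx => by
    simpa using (hL x hx).ne
  have ht : (L ++ m :: R).takeWhile (· ≠ m) = L := by
    rw [List.takeWhile_append_of_pos hne]; simp
  have hd : (L ++ m :: R).dropWhile (· ≠ m) = m :: R := by
    rw [List.dropWhile_append_of_pos hne]; simp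
  rw [popped.eq_def]
  split
  · next h => rw [hmax] at h; cases h
  · next k h =>
    rw [hmax] at h
    cases h
    rw [ht, hd]; rfl

theorem popped_subperm {w : List ℕ} (hw : w.Nodup) : (popped w).Subperm w := by
  induction w, hw using split_induction with
  | nil => rw [popped_nil]
  | split L m R hnd hL hR _ ihR =>
    rw [popped_append_cons L R m hL hR]
    exact (stackSort_perm hnd.of_append_left).subperm.append
      (ihR.trans (List.sublist_cons_self m R).subperm)

theorem nodup_popped {w : List ℕ} (hw : w.Nodup) : (popped w).Nodup := by
  obtain ⟨l, hl, hs⟩ := popped_subperm hw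
  exact hl.nodup_iff.1 (hw.sublist hs)

/-- The greatest letter of a word is always left on the stack. -/
theorem length_popped_lt {w : List ℕ} (hw : w.Nodup) (hne : w ≠ []) :
    (popped w).length < w.length := by
  obtain ⟨L, m, R, rfl, hL, hR⟩ := exists_split hw hne
  have hR' : R.Nodup := hw.of_append_right.of_cons
  have := (popped_subperm hR').length_le
  rw [popped_append_cons L R m hL hR]
  simp only [List.length_append, length_stackSort hw.of_append_left, List.length_cons]
  omega

theorem iterate_popped_eq_nil {k : ℕ} {w : List ℕ} (hw : w.Nodup) (hk : w.length ≤ k) :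
    popped^[k] w = [] := by
  induction k generalizing w with
  | zero => simpa using hk
  | succ k ih =>
    rw [Function.iterate_succ_apply]
    rcases eq_or_ne w [] with rfl | hne
    · rw [popped_nil]; exact ih List.nodup_nil (by simp)
    · have := length_popped_lt hw hne
      exact ih (nodup_popped hw) (by omega)

/-- The letters that form an inversion with a later letter `a`: those that are greater than `a`
and precede it. -/
def inversionsAt (a : ℕ) (w : List ℕ) : List ℕ := (w.takeWhile (· ≠ a)).filter (a < ·)

theorem takeWhile_ne_append_of_mem {a : ℕ} {L R : List ℕ} (h : a ∈ L) :
    (L ++ R).takeWhile (· ≠ a) = L.takeWhile (· ≠ a) := by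
  induction L with
  | nil => simp at h
  | cons x L ih =>
    by_cases hx : x = a
    · simp [hx]
    · have : a ∈ L := by grind
      have := ih this
      simp_all

theorem takeWhile_ne_append_of_notMem {a : ℕ} {L R : List ℕ} (h : a ∉ L) :
    (L ++ R).takeWhile (· ≠ a) = L ++ R.takeWhile (· ≠ a) :=
  List.takeWhile_append_of_pos fun x hx => by
    simpa using fun h' : x = a => h (h' ▸ hx)

/-- A stack sorting pass acts on the inversions at each letter `a` separately, by `popped`: when `a`
enters the stack, the letters greater than `a` that were written are the ones that still precede
`a` afterwards. -/
theorem inversionsAt_stackSort {w : List ℕ} (hw : w.Nodup) {a : ℕ} (ha : a ∈ w) :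
    inversionsAt a (stackSort w) = popped (inversionsAt a w) := by
  induction w, hw using split_induction with
  | nil => simp at ha
  | split L m R hnd hL hR ihL ihR =>
    have hLn : L.Nodup := hnd.of_append_left
    have hRn : R.Nodup := hnd.of_append_right.of_cons
    rw [stackSort_append_cons L R m hL hR]
    by_cases haL : a ∈ L
    · unfold inversionsAt
      rw [takeWhile_ne_append_of_mem haL, List.append_assoc,
        takeWhile_ne_append_of_mem ((mem_stackSort hLn).2 haL)]
      exact ihL haL
    · by_cases ham : a = m
      · subst ham
        have h1 : inversionsAt a (L ++ a :: R) = [] := by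
          simp only [inversionsAt, List.filter_eq_nil_iff, decide_eq_true_eq, not_lt]
          rw [takeWhile_ne_append_of_notMem haL]
          intro x hx
          simp only [ne_eq, not_true_eq_false, decide_false, Bool.false_eq_true,
            not_false_eq_true, List.takeWhile_cons_of_neg, List.append_nil] at hx
          exact (hL x hx).le
        rw [h1, popped_nil]
        simp only [inversionsAt, List.filter_eq_nil_iff, decide_eq_true_eq, not_lt]
        intro x hx
        have := (List.takeWhile_sublist _).subset hx
        simp only [List.append_assoc, List.mem_append, mem_stackSort hLn, mem_stackSort hRn,
          List.mem_singleton] at this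
        rcases this with h | h | h
        · exact (hL x h).le
        · exact (hR x h).le
        · exact h.le
      · have haR : a ∈ R := by simpa [haL, ham] using ha
        have ham' := hR a haR
        have h1 : inversionsAt a (L ++ m :: R) =
            L.filter (a < ·) ++ m :: inversionsAt a R := by
          simp only [inversionsAt]
          rw [takeWhile_ne_append_of_notMem haL,
            List.takeWhile_cons_of_pos (by simpa using Ne.symm ham)]
          simp [ham']
        have h2 : inversionsAt a (stackSort L ++ stackSort R ++ [m]) =
            (stackSort L).filter (a < ·) ++ inversionsAt a (stackSort R) := by
          simp only [inversionsAt]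
          rw [List.append_assoc, takeWhile_ne_append_of_notMem (by rwa [mem_stackSort hLn]),
            takeWhile_ne_append_of_mem (by rwa [mem_stackSort hRn])]
          simp
        rw [h1, h2, popped_append_cons, ihR haR, stackSort_filter hLn]
        · intro x hx; exact hL x (List.mem_filter.1 hx).1
        · intro x hx
          exact hR x ((List.takeWhile_sublist _).subset (List.mem_filter.1 hx).1)

theorem nodup_inversionsAt {w : List ℕ} (hw : w.Nodup) (a : ℕ) : (inversionsAt a w).Nodup :=
  (hw.sublist (List.takeWhile_sublist _)).filter _

theorem iterate_stackSort_perm {w : List ℕ} (hw : w.Nodup) (k : ℕ) :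
    (stackSort^[k] w).Perm w := by
  induction k generalizing w with
  | zero => rfl
  | succ k ih => exact (ih (nodup_stackSort hw)).trans (stackSort_perm hw)

theorem inversionsAt_iterate_stackSort {w : List ℕ} (hw : w.Nodup) {a : ℕ} (ha : a ∈ w)
    (k : ℕ) : inversionsAt a (stackSort^[k] w) = popped^[k] (inversionsAt a w) := by
  induction k generalizing w with
  | zero => rfl
  | succ k ih =>
    rw [Function.iterate_succ_apply, Function.iterate_succ_apply,
      ih (nodup_stackSort hw) ((mem_stackSort hw).2 ha), inversionsAt_stackSort hw ha]

/-- A word is sorted when no letter has inversions. -/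
theorem pairwise_le_iff_inversionsAt (w : List ℕ) (hw : w.Nodup) :
    w.Pairwise (· ≤ ·) ↔ ∀ a ∈ w, inversionsAt a w = [] := by
  induction w with
  | nil => simp
  | cons x w ih =>
    have hx : x ∉ w := (List.nodup_cons.1 hw).1
    rw [List.pairwise_cons, ih hw.of_cons]
    have key : ∀ a ∈ w, (inversionsAt a (x :: w) = [] ↔ x ≤ a ∧ inversionsAt a w = []) := by
      intro a ha
      have hxa : x ≠ a := fun h => hx (h ▸ ha)
      unfold inversionsAt
      rw [List.takeWhile_cons_of_pos (by simpa using hxa), List.filter_cons]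
      by_cases hax : a < x
      · simp [hax]
      · simp [hax, not_lt.1 hax]
    have h0 : inversionsAt x (x :: w) = [] := by simp [inversionsAt]
    simp only [List.mem_cons, forall_eq_or_imp, h0, true_and]
    constructor
    · rintro ⟨h1, h2⟩ a ha
      exact (key a ha).2 ⟨h1 a ha, h2 a ha⟩
    · intro h
      exact ⟨fun a ha => ((key a ha).1 (h a ha)).1, fun a ha => ((key a ha).1 (h a ha)).2⟩

theorem nodup_idWord (n : ℕ) : (idWord n).Nodup := List.nodup_range'

theorem nodup_of_mem_perms {n : ℕ} {w : List ℕ} (hw : w ∈ perms n) : w.Nodup :=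
  (List.Perm.nodup_iff hw).2 (nodup_idWord n)

theorem mem_iff_of_mem_perms {n : ℕ} {w : List ℕ} (hw : w ∈ perms n) {x : ℕ} :
    x ∈ w ↔ 1 ≤ x ∧ x ≤ n := by
  rw [List.Perm.mem_iff hw, idWord, List.mem_range'_1]
  omega

theorem length_of_mem_perms {n : ℕ} {w : List ℕ} (hw : w ∈ perms n) : w.length = n := by
  rw [List.Perm.length_eq hw, idWord, List.length_range']

/-- A permutation is sorted after `k` passes when `k` applications of `popped` empty the words of
inversions at all of its letters. -/
theorem iterate_stackSort_eq_idWord_iff {n : ℕ} {w : List ℕ} (hw : w ∈ perms n) (k : ℕ) :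
    stackSort^[k] w = idWord n ↔ ∀ a ∈ w, popped^[k] (inversionsAt a w) = [] := by
  have hnd := nodup_of_mem_perms hw
  have hp := iterate_stackSort_perm hnd k
  have h1 : stackSort^[k] w = idWord n ↔ (stackSort^[k] w).Pairwise (· ≤ ·) := by
    constructor
    · intro h
      rw [h]
      exact (List.pairwise_lt_range').imp le_of_lt
    · intro h
      exact (hp.trans hw).eq_of_pairwise (fun a b _ _ => le_antisymm) h
        ((List.pairwise_lt_range').imp le_of_lt)
  rw [h1, pairwise_le_iff_inversionsAt _ (hp.nodup_iff.2 hnd)]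
  refine forall_congr' fun a => ?_
  rw [hp.mem_iff]
  exact forall_congr' fun ha => by rw [inversionsAt_iterate_stackSort hnd ha]

theorem iterate_popped_eq_nil_of_le {w : List ℕ} {j k : ℕ} (hjk : j ≤ k)
    (h : popped^[j] w = []) : popped^[k] w = [] := by
  obtain ⟨d, rfl⟩ := Nat.exists_eq_add_of_le hjk
  rw [add_comm, Function.iterate_add_apply, h]
  exact iterate_popped_eq_nil List.nodup_nil (by simp)

theorem mem_exactly_succ_iff {n k : ℕ} {w : List ℕ} (hw : w ∈ perms n) :
    w ∈ exactly n (k + 1) ↔ (∀ a ∈ w, popped^[k + 1] (inversionsAt a w) = []) ∧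
      ∃ a ∈ w, popped^[k] (inversionsAt a w) ≠ [] := by
  have : w ∈ exactly n (k + 1) ↔ IsLeast {j : ℕ | stackSort^[j] w = idWord n} (k + 1) :=
    and_iff_right hw
  rw [this]
  simp only [IsLeast, lowerBounds, Set.mem_ofPred_eq, iterate_stackSort_eq_idWord_iff hw]
  refine and_congr_right fun _ => ?_
  constructor
  · intro h
    by_contra! hcon
    have := h hcon
    omega
  · rintro ⟨a, ha, hne⟩ j hj
    by_contra! hlt
    exact hne (iterate_popped_eq_nil_of_le (by omega) (hj a ha))

/-! ### Words that are emptied slowly -/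

/-- `w` is slow with slack `s` if emptying it takes at least `|w| - s` applications of `popped`.
Every application removes at least one letter, so `s` bounds the number of letters that are
removed in excess of one per application. -/
def Slow (s : ℕ) (w : List ℕ) : Prop := ∀ j, popped^[j] w = [] → w.length ≤ j + s

theorem iterate_popped_ne_nil_iff {k s : ℕ} {w : List ℕ} (h : w.length = k + 1 + s) :
    popped^[k] w ≠ [] ↔ Slow s w := by
  constructor
  · intro hne j hj
    by_contra! hlt
    exact hne (iterate_popped_eq_nil_of_le (by omega) hj)
  · intro hs hk
    have := hs k hk
    omega

theorem slow_nil (s : ℕ) : Slow s [] := fun _ _ => by simp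

theorem slow_append_cons_iff {s : ℕ} {L R : List ℕ} {m : ℕ} (hL : ∀ x ∈ L, x < m)
    (hR : ∀ x ∈ R, x < m) :
    Slow s (L ++ m :: R) ↔
      ∀ j, popped^[j] (stackSort L ++ popped R) = [] → L.length + R.length ≤ j + s := by
  constructor
  · intro h j hj
    have := h (j + 1) (by rwa [Function.iterate_succ_apply, popped_append_cons L R m hL hR])
    simp only [List.length_append, List.length_cons] at this
    omega
  · intro h j hj
    rcases j with _ | j
    · simp at hj
    · rw [Function.iterate_succ_apply, popped_append_cons L R m hL hR] at hj
      have := h j hj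
      simp only [List.length_append, List.length_cons]
      omega

/-- If `popped` removes `d + 1` letters from `R`, it removes `d + 2` letters from `L m R`, and so
uses up `d + 1` of the slack. -/
theorem slow_append_cons_iff_of_length {s d : ℕ} {L R : List ℕ} {m : ℕ}
    (hnd : (L ++ m :: R).Nodup) (hL : ∀ x ∈ L, x < m) (hR : ∀ x ∈ R, x < m)
    (hd : (popped R).length + (d + 1) = R.length) :
    Slow (s + d + 1) (L ++ m :: R) ↔ Slow s (stackSort L ++ popped R) := by
  rw [slow_append_cons_iff hL hR]
  refine forall_congr' fun j => forall_congr' fun _ => ?_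
  rw [List.length_append, length_stackSort hnd.of_append_left]
  omega

/-- The slack bounds the number of letters that `popped` removes from the part after the greatest
letter. -/
theorem length_le_of_slow_append_cons {s : ℕ} {L R : List ℕ} {m : ℕ} (hnd : (L ++ m :: R).Nodup)
    (hL : ∀ x ∈ L, x < m) (hR : ∀ x ∈ R, x < m)
    (h : Slow s (L ++ m :: R)) :
    R.length ≤ (popped R).length + s := by
  have hLn := hnd.of_append_left
  have hRn := hnd.of_append_right.of_cons
  have hd : (stackSort L ++ popped R).Nodup := by
    rw [← popped_append_cons L R m hL hR]
    exact nodup_popped hnd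
  have := (slow_append_cons_iff hL hR).1 h _ (iterate_popped_eq_nil hd le_rfl)
  rw [List.length_append, length_stackSort hLn] at this
  omega

/-- If the greatest letter comes last, then `popped` removes only that letter, and what is left is
the output of a pass, in which the greatest letter comes last again. -/
theorem slow_zero_concat {Q : List ℕ} {m : ℕ} (hnd : (Q ++ [m]).Nodup) (hQ : ∀ x ∈ Q, x < m) :
    Slow 0 (Q ++ [m]) := by
  induction hk : Q.length using Nat.strong_induction_on generalizing Q m with
  | _ k ih =>
    have hQn := hnd.of_append_left
    rw [slow_append_cons_iff hQ (by simp), popped_nil, List.append_nil]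
    suffices h : Slow 0 (stackSort Q) by
      intro j hj
      have := h j hj
      rw [length_stackSort hQn] at this
      simpa using this
    rcases eq_or_ne Q [] with rfl | hne
    · rw [stackSort_nil]; exact slow_nil 0
    · have hS := nodup_stackSort hQn
      obtain ⟨A, x, B, rfl, hA, hB⟩ := exists_split hQn hne
      rw [stackSort_append_cons A B x hA hB] at hS ⊢
      have hAn := hQn.of_append_left
      have hBn := hQn.of_append_right.of_cons
      refine ih (stackSort A ++ stackSort B).length ?_ hS ?_ rfl
      · simp only [List.length_append, List.length_cons, length_stackSort hAn,
          length_stackSort hBn] at hk ⊢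
        omega
      · intro y hy
        rcases List.mem_append.1 hy with h | h
        · exact hA y ((mem_stackSort hAn).1 h)
        · exact hB y ((mem_stackSort hBn).1 h)

theorem slow_zero_append_cons_iff {L R : List ℕ} {m : ℕ} (hnd : (L ++ m :: R).Nodup)
    (hL : ∀ x ∈ L, x < m) (hR : ∀ x ∈ R, x < m) : Slow 0 (L ++ m :: R) ↔ R = [] := by
  constructor
  · intro h
    by_contra hne
    have h1 := length_le_of_slow_append_cons hnd hL hR h
    have h2 := length_popped_lt hnd.of_append_right.of_cons hne
    omega
  · rintro rfl
    exact slow_zero_concat hnd hL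

theorem idxOf_append_cons {L R : List ℕ} {m : ℕ} (hnd : (L ++ m :: R).Nodup) :
    (L ++ m :: R).idxOf m = L.length := by
  have : m ∉ L := fun h => by
    rw [List.nodup_append] at hnd
    exact hnd.2.2 m h m (by simp) rfl
  rw [List.idxOf_append_of_notMem this]
  simp

/-- With slack `0`: the greatest letter comes last. -/
theorem slow_zero_iff {P : List ℕ} (hnd : P.Nodup) {t : ℕ} (ht : t ∈ P)
    (hle : ∀ x ∈ P, x ≤ t) : Slow 0 P ↔ P.idxOf t + 1 = P.length := by
  obtain ⟨L, R, rfl⟩ := List.append_of_mem ht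
  have h := hnd
  rw [List.nodup_append, List.nodup_cons] at h
  have hL : ∀ x ∈ L, x < t := fun x hx =>
    lt_of_le_of_ne (hle x (by simp [hx])) (h.2.2 x hx t (by simp))
  have hR : ∀ x ∈ R, x < t := fun x hx =>
    lt_of_le_of_ne (hle x (by simp [hx])) (fun h' => h.2.1.1 (h' ▸ hx))
  rw [slow_zero_append_cons_iff hnd hL hR, idxOf_append_cons hnd, ← List.length_eq_zero_iff]
  simp only [List.length_append, List.length_cons]
  omega

theorem slow_zero_stackSort {L : List ℕ} (hL : L.Nodup) : Slow 0 (stackSort L) := by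
  rcases eq_or_ne L [] with rfl | hne
  · rw [stackSort_nil]; exact slow_nil 0
  · have hS := nodup_stackSort hL
    obtain ⟨A, x, B, rfl, hA, hB⟩ := exists_split hL hne
    rw [stackSort_append_cons A B x hA hB] at hS ⊢
    refine slow_zero_concat hS fun y hy => ?_
    rcases List.mem_append.1 hy with h | h
    · exact hA y ((mem_stackSort hL.of_append_left).1 h)
    · exact hB y ((mem_stackSort hL.of_append_right.of_cons).1 h)

theorem idxOf_stackSort_of_forall_le {w : List ℕ} (hw : w.Nodup) {t : ℕ} (ht : t ∈ w)
    (hle : ∀ x ∈ w, x ≤ t) : (stackSort w).idxOf t + 1 = w.length := by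
  rw [← length_stackSort hw, ← slow_zero_iff (nodup_stackSort hw) ((mem_stackSort hw).2 ht)]
  · exact slow_zero_stackSort hw
  · exact fun x hx => hle x ((mem_stackSort hw).1 hx)

theorem slow_zero_append_stackSort_iff {A B : List ℕ} (hnd : (A ++ B).Nodup) (hB : B ≠ []) :
    Slow 0 (A ++ stackSort B) ↔ ∃ t ∈ B, ∀ x ∈ A, x < t := by
  have hBn := hnd.of_append_right
  have hnd' : (A ++ stackSort B).Nodup := ((stackSort_perm hBn).append_left A).nodup_iff.2 hnd
  obtain ⟨C, t, D, rfl, hC, hD⟩ := exists_split hBn hB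
  have hle : ∀ x ∈ C ++ t :: D, x ≤ t := by grind
  have hCn := hBn.of_append_left
  have hDn := hBn.of_append_right.of_cons
  rw [stackSort_append_cons C D t hC hD] at hnd' ⊢
  constructor
  · intro h
    refine ⟨t, by simp, fun x hx => ?_⟩
    by_contra! hlt
    obtain ⟨E, y, F, hE, hEy, hFy⟩ := exists_split hnd' (by simp)
    rw [hE] at h hnd'
    rw [slow_zero_append_cons_iff hnd' hEy hFy] at h
    subst h
    have hyt : t = y := by
      have := congrArg List.getLast? hE
      simpa using this
    have hxE : x ∈ A ++ (stackSort C ++ stackSort D ++ [t]) := by simp [hx]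
    rw [hE] at hxE
    rcases List.mem_append.1 hxE with h' | h'
    · have := hEy x h'
      omega
    · rw [List.nodup_append] at hnd
      refine hnd.2.2 x hx t (by simp) ?_
      simp at h'
      omega
  · rintro ⟨u, hu, hAu⟩
    rw [← List.append_assoc] at hnd' ⊢
    refine slow_zero_concat hnd' fun x hx => ?_
    rw [List.mem_append, List.mem_append, mem_stackSort hCn, mem_stackSort hDn] at hx
    rcases hx with h | h | h
    · exact (hAu x h).trans_le (hle u hu)
    · exact hC x h
    · exact hD x h

theorem popped_concat {Q : List ℕ} {m : ℕ} (hQ : ∀ x ∈ Q, x < m) :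
    popped (Q ++ [m]) = stackSort Q := by
  rw [popped_append_cons Q [] m hQ (by simp), popped_nil, List.append_nil]

/-! ### Slack one -/

/-- Membership in the parts of a decomposition, read off from places. -/
theorem mem_iff_idxOf {P L R : List ℕ} {m : ℕ} (h : P = L ++ m :: R) (hnd : P.Nodup) {x : ℕ}
    (hx : x ∈ P) : (x ∈ L ↔ P.idxOf x < L.length) ∧ (x = m ↔ P.idxOf x = L.length) ∧
      (x ∈ R ↔ L.length < P.idxOf x) := by
  subst h
  have hnd' := hnd
  rw [List.nodup_append, List.nodup_cons] at hnd'
  obtain ⟨-, ⟨hm, -⟩, hd⟩ := hnd'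
  by_cases h : x ∈ L
  · have := List.idxOf_lt_length_of_mem h
    have h1 := hd x h x
    have h2 := hd x h m (by simp)
    rw [List.idxOf_append_of_mem h]
    simp only [List.mem_cons] at h1
    have h3 : x ∉ R := fun h' => h1 (Or.inr h') rfl
    exact ⟨iff_of_true h this, iff_of_false h2 this.ne, iff_of_false h3 (by omega)⟩
  · by_cases hxm : x = m
    · subst hxm
      rw [idxOf_append_cons hnd]
      exact ⟨iff_of_false h (lt_irrefl _), iff_of_true rfl rfl, iff_of_false hm (lt_irrefl _)⟩
    · have hR : x ∈ R := by simpa [h, hxm] using hx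
      rw [List.idxOf_append_of_notMem h, List.idxOf_cons_ne _ (Ne.symm hxm)]
      exact ⟨iff_of_false h (by omega), iff_of_false hxm (by omega), iff_of_true hR (by omega)⟩

theorem idxOf_ne_of_mem {w : List ℕ} {x y : ℕ} (hx : x ∈ w) (hxy : x ≠ y) :
    w.idxOf x ≠ w.idxOf y := fun h => hxy ((List.idxOf_inj hx).1 h)

/-- Either the greatest letter of a nonempty word comes last, and then `popped` removes just
that letter, or it removes at least two letters. -/
theorem concat_or_append_cons {w : List ℕ} (hw : w.Nodup) (hne : w ≠ []) :
    (∃ Q m, w = Q ++ [m] ∧ (∀ x ∈ Q, x < m) ∧ popped w = stackSort Q) ∨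
      ∃ Q m B, w = Q ++ m :: B ∧ B ≠ [] ∧ (∀ x ∈ Q, x < m) ∧ (∀ x ∈ B, x < m) ∧
        popped w = stackSort Q ++ popped B := by
  obtain ⟨Q, m, B, rfl, hQ, hB⟩ := exists_split hw hne
  rcases eq_or_ne B [] with rfl | hB0
  · exact Or.inl ⟨Q, m, rfl, hQ, popped_concat hQ⟩
  · exact Or.inr ⟨Q, m, B, rfl, hB0, hQ, hB, popped_append_cons Q B m hQ hB⟩

/-- With slack `1`, in terms of the places of the three greatest letters `t₁ > t₂ > t₃`:
the word has the form `∗ t₁`, `∗ t₁ ?` or `∗ t₁ ∗ t₃ ∗ t₂`. -/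
theorem slow_one_iff {P : List ℕ} (hnd : P.Nodup) {t₁ t₂ t₃ : ℕ} (h₁ : t₁ ∈ P) (h₂ : t₂ ∈ P)
    (h₃ : t₃ ∈ P) (h₁₂ : t₂ < t₁) (h₂₃ : t₃ < t₂)
    (hle : ∀ x ∈ P, x = t₁ ∨ x = t₂ ∨ x ≤ t₃) :
    Slow 1 P ↔ P.length ≤ P.idxOf t₁ + 2 ∨
      (P.idxOf t₁ < P.idxOf t₃ ∧ P.idxOf t₃ < P.idxOf t₂ ∧ P.idxOf t₂ + 1 = P.length) := by
  obtain ⟨L, M, R, hP, hL, hR⟩ := exists_split hnd (List.ne_nil_of_mem h₁)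
  have hnd' := hP ▸ hnd
  have hLn := hnd'.of_append_left
  have hRn := hnd'.of_append_right.of_cons
  have hLR : (L ++ R).Nodup := hnd'.sublist ((List.sublist_cons_self M R).append_left L)
  have n₂₃ := idxOf_ne_of_mem h₂ h₂₃.ne'
  have hlt : ∀ x ∈ P, P.idxOf x < P.length := fun x => List.idxOf_lt_length_of_mem
  have hloc := fun x hx => mem_iff_idxOf (x := x) hP hnd hx
  have hMP : M ∈ P := by simp [hP]
  have hltM : ∀ x ∈ P, x = M ∨ x < M := fun x hx => by
    rw [hP] at hx
    rcases List.mem_append.1 hx with h | h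
    · exact Or.inr (hL x h)
    · rcases List.mem_cons.1 h with h | h
      · exact Or.inl h
      · exact Or.inr (hR x h)
  have hlen : P.length = L.length + 1 + R.length := by rw [hP]; simp; omega
  have hM : M = t₁ := by
    have := hltM t₁ h₁
    have := hle M hMP
    omega
  subst hM
  have i₁ := (hloc M hMP).2.1.1 rfl
  have l₂ := hloc t₂ h₂
  have l₃ := hloc t₃ h₃
  rcases eq_or_ne R [] with rfl | hR0
  · have := slow_zero_concat hnd' hL
    rw [← hP] at this
    refine iff_of_true (fun j hj => (this j hj).trans (by omega)) ?_
    simp only [List.length_nil] at hlen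
    omega
  -- if `R = Q m`, the slack is used up by the removal of `m`; if `R = Q m B` with `B` nonempty,
  -- then `popped` removes a letter of `B` too, which is one too many
  rcases concat_or_append_cons hRn hR0 with ⟨Q, m, hRQ, hQ, hp⟩ | ⟨Q, m, B, hRQ, hB0, hQ, hB, hp⟩
  · have hQn := (hRQ ▸ hRn).of_append_left
    have hS : Slow 1 P ↔ Slow 0 (stackSort L ++ stackSort Q) := by
      rw [← hp, hP]
      refine slow_append_cons_iff_of_length (s := 0) (d := 0) hnd' hL hR ?_
      rw [hp, length_stackSort hQn, hRQ]
      simp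
    rw [hS]
    have hlen' : R.length = Q.length + 1 := by simp [hRQ]
    rcases eq_or_ne Q [] with rfl | hQ0
    · rw [stackSort_nil, List.append_nil]
      refine iff_of_true (slow_zero_stackSort hLn) ?_
      simp only [List.length_nil] at hlen'
      omega
    · have hnd' : (stackSort L ++ Q).Nodup := by
        refine ((stackSort_perm hLn).append_right Q).nodup_iff.2 (hLR.sublist ?_)
        rw [hRQ]
        exact (List.sublist_append_left Q [m]).append_left L
      rw [slow_zero_append_stackSort_iff hnd' hQ0]
      simp only [mem_stackSort hLn]
      have hQl := List.length_pos_iff.2 hQ0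
      have hloc' := fun x hx =>
        mem_iff_idxOf (x := x) (P := P) (L := L ++ M :: Q) (m := m) (R := []) (by simp [hP, hRQ])
          hnd hx
      have hQP : ∀ x ∈ Q, x ∈ P := fun x hx => by simp [hP, hRQ, hx]
      have hLP : ∀ x ∈ L, x ∈ P := fun x hx => by simp [hP, hx]
      have hmP : m ∈ P := by simp [hP, hRQ]
      have hQ' : ∀ x ∈ P, x ∈ Q ↔ L.length < P.idxOf x ∧ P.idxOf x < L.length + 1 + Q.length := by
        intro x hx
        have h1 := (hloc x hx).2.2
        have h2 := (hloc' x hx).2.1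
        have h3 := hlt x hx
        have h4 : x ∈ R ↔ x ∈ Q ∨ x = m := by simp [hRQ]
        have h5 : x ∈ Q → x ≠ m := fun h => (hQ x h).ne
        simp only [List.length_append, List.length_cons] at h2
        grind
      have hF : ∀ x ∈ P, P.idxOf x < P.length ∧ (x = M ↔ P.idxOf x = L.length) ∧
          (x = m ↔ P.idxOf x = L.length + 1 + Q.length) ∧
          (L.length < P.idxOf x → P.idxOf x < L.length + 1 + Q.length → x < m) ∧
          (x ≤ M) ∧ (x = M ∨ x = t₂ ∨ x ≤ t₃) := by
        intro x hx
        refine ⟨hlt x hx, (hloc x hx).2.1, ?_, fun h h' => hQ x ((hQ' x hx).2 ⟨h, h'⟩),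
          (hltM x hx).elim le_of_eq le_of_lt, hle x hx⟩
        rw [(hloc' x hx).2.1]
        simp only [List.length_append, List.length_cons]
        omega
      have f₂ := hF t₂ h₂
      have f₃ := hF t₃ h₃
      have fm := hF m hmP
      constructor
      · rintro ⟨t, ht, hltt⟩
        have ft := hF t (hQP t ht)
        have ht' := (hQ' t (hQP t ht)).1 ht
        have g₂ : P.idxOf t₂ < L.length → t₂ < t := fun h => hltt t₂ ((hloc t₂ h₂).1.2 h)
        have g₃ : P.idxOf t₃ < L.length → t₃ < t := fun h => hltt t₃ ((hloc t₃ h₃).1.2 h)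
        omega
      · intro h
        refine ⟨t₃, (hQ' t₃ h₃).2 (by omega), fun x hx => ?_⟩
        have fx := hF x (hLP x hx)
        have hx' := (hloc x (hLP x hx)).1.1 hx
        have hx₃ : x = t₃ → P.idxOf x = P.idxOf t₃ := fun h => by rw [h]
        have hx₂ : x = t₂ → P.idxOf x = P.idxOf t₂ := fun h => by rw [h]
        omega
  · constructor
    · intro h
      rw [hP] at h
      have h1 := length_le_of_slow_append_cons hnd' hL hR h
      have h2 := length_popped_lt (hRQ ▸ hRn).of_append_right.of_cons hB0
      rw [hp, hRQ] at h1
      simp only [List.length_append, List.length_cons,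
        length_stackSort (hRQ ▸ hRn).of_append_left] at h1
      omega
    · intro h
      exfalso
      have hBl := List.length_pos_iff.2 hB0
      have hmP : m ∈ P := by simp [hP, hRQ]
      have hm := hle m hmP
      have hmM := hltM m hmP
      have hloc' :=
        mem_iff_idxOf (x := t₂) (P := P) (L := L ++ M :: Q) (m := m) (R := B) (by simp [hP, hRQ])
          hnd h₂
      have h3 := hR m (by simp [hRQ])
      have h4 : L.length + 1 + Q.length < P.idxOf t₂ → t₂ < m := fun h =>
        hB t₂ (hloc'.2.2.2 (by simp only [List.length_append, List.length_cons]; omega))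
      have h5 : t₂ = m → P.idxOf t₂ = L.length + 1 + Q.length := fun h => by
        rw [hloc'.2.1.1 h]
        simp
        omega
      have h6 := hlt t₂ h₂
      simp only [hRQ, List.length_append, List.length_cons] at hlen
      omega

/-! ### Slack two -/

theorem idxOf_append_stackSort {A B : List ℕ} (hnd : (A ++ B).Nodup) {t : ℕ} (ht : t ∈ B)
    (hle : ∀ x ∈ B, x ≤ t) : (A ++ stackSort B).idxOf t + 1 = A.length + B.length := by
  have hA : t ∉ A := fun h => (List.nodup_append.1 hnd).2.2 t h t ht rfl
  have := idxOf_stackSort_of_forall_le hnd.of_append_right ht hle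
  rw [List.idxOf_append_of_notMem hA]
  omega

/-- Slack `1` for `S(L) S(Q)`, where `t₁ > t₂ > t₃` are the greatest letters. Both parts end in
their greatest letters, which leaves few of the words of `slow_one_iff`. -/
theorem slow_one_stackSort_append_stackSort_iff {L Q : List ℕ} (hnd : (L ++ Q).Nodup)
    {t₁ t₂ t₃ : ℕ} (h₁ : t₁ ∈ L ++ Q) (h₂ : t₂ ∈ L ++ Q) (h₃ : t₃ ∈ L ++ Q) (h₁₂ : t₂ < t₁)
    (h₂₃ : t₃ < t₂) (hle : ∀ x ∈ L ++ Q, x = t₁ ∨ x = t₂ ∨ x ≤ t₃) :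
    Slow 1 (stackSort L ++ stackSort Q) ↔ Q.length ≤ 1 ∨ t₁ ∈ Q ∨ (t₂ ∈ Q ∧ t₃ ∈ Q) := by
  have hLn := hnd.of_append_left
  have hQn := hnd.of_append_right
  have hdis := (List.nodup_append.1 hnd).2.2
  have hp : (stackSort L ++ stackSort Q).Perm (L ++ Q) :=
    (stackSort_perm hLn).append (stackSort_perm hQn)
  have hnd' : (stackSort L ++ Q).Nodup := ((stackSort_perm hLn).append_right Q).nodup_iff.2 hnd
  have hle' : ∀ x ∈ L ++ Q, x ≤ t₁ := fun x hx => by have := hle x hx; omega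
  rw [slow_one_iff (hp.nodup_iff.2 hnd) (hp.mem_iff.2 h₁) (hp.mem_iff.2 h₂) (hp.mem_iff.2 h₃)
    h₁₂ h₂₃ fun x hx => hle x (hp.mem_iff.1 hx)]
  have n₂₃ := idxOf_ne_of_mem (hp.mem_iff.2 h₂) h₂₃.ne'
  have hlt : ∀ x ∈ L ++ Q, (stackSort L ++ stackSort Q).idxOf x < L.length + Q.length := by
    intro x hx
    have := List.idxOf_lt_length_of_mem (hp.mem_iff.2 hx)
    rwa [hp.length_eq, List.length_append] at this
  have hltL : ∀ x ∈ L, (stackSort L ++ stackSort Q).idxOf x < L.length := by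
    intro x hx
    have hx' := (mem_stackSort hLn).2 hx
    rw [List.idxOf_append_of_mem hx', ← length_stackSort hLn]
    exact List.idxOf_lt_length_of_mem hx'
  have hleQ : ∀ x ∈ Q, L.length ≤ (stackSort L ++ stackSort Q).idxOf x := by
    intro x hx
    rw [List.idxOf_append_of_notMem, length_stackSort hLn]
    · omega
    · rw [mem_stackSort hLn]
      exact fun h => hdis x h x hx rfl
  rw [hp.length_eq, List.length_append]
  by_cases hQ : t₁ ∈ Q
  · have := idxOf_append_stackSort hnd' hQ (fun x hx => hle' x (by simp [hx]))
    rw [length_stackSort hLn] at this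
    exact iff_of_true (Or.inl (by omega)) (Or.inr (Or.inl hQ))
  · have hL : t₁ ∈ L := by simpa [hQ] using h₁
    have i₁ : (stackSort L ++ stackSort Q).idxOf t₁ + 1 = L.length := by
      rw [List.idxOf_append_of_mem ((mem_stackSort hLn).2 hL)]
      exact idxOf_stackSort_of_forall_le hLn hL (fun x hx => hle' x (by simp [hx]))
    have hor : Q.length ≤ 1 ↔ L.length + Q.length ≤ L.length - 1 + 2 := by omega
    simp only [hQ, false_or]
    refine or_congr (by omega) ?_
    constructor
    · rintro ⟨h1, h2, -⟩
      constructor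
      · by_contra h
        have := hltL t₂ (by simpa [h] using h₂)
        omega
      · by_contra h
        have := hltL t₃ (by simpa [h] using h₃)
        omega
    · rintro ⟨h2, h3⟩
      have i₂ := idxOf_append_stackSort hnd' h2 fun x hx => by
        have := hle x (by simp [hx])
        have : x ≠ t₁ := fun h => hQ (h ▸ hx)
        omega
      rw [length_stackSort hLn] at i₂
      have := hleQ t₃ h3
      have := hlt t₃ h₃
      omega

/-- The condition for slack `2` on a word of length `N` whose five greatest letters
`t₁ > t₂ > t₃ > t₄ > t₅` stand at the places `p₁, …, p₅`, counted from `0`. In order, the word has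
the form `∗ t₁`, `∗ t₁ ?` or `∗ t₁ ? ?`; `∗ t₁ ∗ t₃ ∗ t₂`; `∗ t₃ ∗ t₁ ∗ t₂` or `∗ t₂ ∗ t₁ ∗ t₃` with
`t₄` and `t₅` after `t₁`; `∗ t₁ ∗ t₄ ∗ t₂ t₃`; `∗ t₁ ∗ t₃ ∗ t₂ ?`; `∗ t₁ ∗ t₂ ∗ t₄ ∗ t₃`. -/
def SlowTwoShape (N p₁ p₂ p₃ p₄ p₅ : ℕ) : Prop :=
  N ≤ p₁ + 3 ∨
    (p₂ + 1 = N ∧ p₁ < p₃) ∨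
    (p₂ + 1 = N ∧ p₃ < p₁ ∧ p₁ < p₄ ∧ p₁ < p₅) ∨
    (p₃ + 1 = N ∧ p₂ < p₁ ∧ p₁ < p₄ ∧ p₁ < p₅) ∨
    (p₃ + 1 = N ∧ p₂ + 2 = N ∧ p₁ < p₄) ∨
    (p₂ + 2 = N ∧ p₁ < p₃ ∧ p₃ < p₂) ∨
    (p₃ + 1 = N ∧ p₁ < p₂ ∧ p₂ < p₄)

set_option maxHeartbeats 1000000 in
/-- For a word `L t₁ Q m C z`, where `t₁ > m > z` are its right-to-left maxima, `SlowTwoShape` says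
that in `S(L) S(Q) S(C)` the greatest letter comes last. -/
theorem slowTwoShape_iff_of_eq {P L Q C : List ℕ} {t₁ m z t₂ t₃ t₄ t₅ : ℕ} (hnd : P.Nodup)
    (hP : P = L ++ t₁ :: (Q ++ m :: (C ++ [z]))) (hL : ∀ x ∈ L, x < t₁)
    (hR : ∀ x ∈ Q ++ m :: (C ++ [z]), x < t₁) (hQ : ∀ x ∈ Q, x < m) (hzm : z < m)
    (hC : ∀ x ∈ C, x < z) (h₁ : t₁ ∈ P)
    (h₂ : t₂ ∈ P) (h₃ : t₃ ∈ P) (h₄ : t₄ ∈ P) (h₁₂ : t₂ < t₁) (h₂₃ : t₃ < t₂)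
    (h₃₄ : t₄ < t₃) (h₄₅ : t₅ < t₄)
    (hle : ∀ x ∈ P, x = t₁ ∨ x = t₂ ∨ x = t₃ ∨ x = t₄ ∨ x ≤ t₅) :
    (∃ t ∈ C, (∀ x ∈ L, x < t) ∧ ∀ x ∈ Q, x < t) ∨
        (C.length = 0 ∧ (Q.length = 0 ∨ ∃ t ∈ Q, ∀ x ∈ L, x < t)) ↔
      SlowTwoShape P.length (P.idxOf t₁) (P.idxOf t₂) (P.idxOf t₃) (P.idxOf t₄)
        (P.idxOf t₅) := by
  have hlt : ∀ x ∈ P, P.idxOf x < P.length := fun x => List.idxOf_lt_length_of_mem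
  have hloc := fun x hx => mem_iff_idxOf (x := x) hP hnd hx
  have hlocm := fun x hx =>
    mem_iff_idxOf (x := x) (P := P) (L := L ++ t₁ :: Q) (m := m) (R := C ++ [z]) (by simp [hP])
      hnd hx
  have hlocz := fun x hx =>
    mem_iff_idxOf (x := x) (P := P) (L := L ++ t₁ :: (Q ++ m :: C)) (m := z) (R := [])
      (by simp [hP]) hnd hx
  simp only [List.length_append, List.length_cons] at hlocm hlocz
  have hlen : P.length = L.length + 1 + (Q.length + 1 + (C.length + 1)) := by
    rw [hP]; simp; omega
  have i₁ := (hloc t₁ h₁).2.1.1 rfl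
  have n₂₃ := idxOf_ne_of_mem h₂ h₂₃.ne'
  have n₃₄ := idxOf_ne_of_mem h₃ h₃₄.ne'
  have n₂₄ := idxOf_ne_of_mem h₂ (h₃₄.trans h₂₃).ne'
  have hLP : ∀ x ∈ L, x ∈ P := fun x hx => by simp [hP, hx]
  have hmP : m ∈ P := by simp [hP]
  have hzP : z ∈ P := by simp [hP]
  have hmle := hle m hmP
  have hzle := hle z hzP
  have hmM := hR m (by simp)
  unfold SlowTwoShape
  have hF : ∀ x ∈ P, x ≠ t₁ → (P.idxOf x < L.length ∧ x ∈ L) ∨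
      (L.length < P.idxOf x ∧ P.idxOf x < L.length + (Q.length + 1) ∧ x < m ∧ x ∈ Q) ∨
      (P.idxOf x = L.length + (Q.length + 1) ∧ x = m) ∨
      (L.length + (Q.length + 1) < P.idxOf x ∧
        P.idxOf x < L.length + (Q.length + (C.length + 1) + 1) ∧ x < z ∧ x ∈ C) ∨
      (P.idxOf x = L.length + (Q.length + (C.length + 1) + 1) ∧ x = z) := by
    intro x hx hxM
    have h1 : P.idxOf x ≠ L.length := fun h => hxM ((hloc x hx).2.1.2 h)
    have h2 := (hlocm x hx).2.1.2
    have h3 := (hlocz x hx).2.1.2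
    have h4 := fun h => (hlocm x hx).2.2.2 h
    have h5 := (hloc x hx).1.2
    have h6 := (hloc x hx).2.2.2
    have h7 := (hlocz x hx).2.2.2
    have h8 : x ∈ Q ++ m :: (C ++ [z]) ↔ x ∈ Q ∨ x = m ∨ x ∈ C ++ [z] := by simp
    have h9 : x ∈ C ++ [z] ↔ x ∈ C ∨ x = z := by simp
    have hQ := hQ x
    have hC := hC x
    have h10 := (hlocm x hx).2.2.1
    have h11 := (hlocm x hx).2.1.1
    have h12 := (hlocz x hx).2.1.1
    simp only [List.not_mem_nil] at h7
    clear * - h1 h2 h3 h4 h5 h6 h7 h8 h9 h10 h11 h12 hQ hC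
    generalize P.idxOf x = p at *
    generalize L.length = l, Q.length = q, C.length = c at *
    grind
  have hQP : ∀ x ∈ Q, x ∈ P ∧ L.length < P.idxOf x ∧ P.idxOf x < L.length + (Q.length + 1) := by
    intro x hx
    have hxP : x ∈ P := by simp [hP, hx]
    have h1 := (hloc x hxP).2.2.1 (by simp [hx])
    have h2 := (hlocm x hxP).1.1 (by simp [hx])
    exact ⟨hxP, h1, h2⟩
  have hCP : ∀ x ∈ C, x ∈ P ∧ L.length + (Q.length + 1) < P.idxOf x ∧
      P.idxOf x < L.length + (Q.length + (C.length + 1) + 1) := by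
    intro x hx
    have hxP : x ∈ P := by simp [hP, hx]
    have h1 := (hlocm x hxP).2.2.1 (by simp [hx])
    have h2 := (hlocz x hxP).1.1 (by simp [hx])
    exact ⟨hxP, h1, h2⟩
  have em : ∀ t, m = t → P.idxOf t = L.length + (Q.length + 1) := by
    rintro t rfl
    exact (hlocm m hmP).2.1.1 rfl
  have ez : ∀ t, z = t → P.idxOf t = L.length + (Q.length + (C.length + 1) + 1) := by
    rintro t rfl
    exact (hlocz z hzP).2.1.1 rfl
  have hinj : ∀ x ∈ P, ∀ y, x = y → P.idxOf x = P.idxOf y := fun x _ y h => by rw [h]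
  have n₂ : t₂ ≠ t₁ := by omega
  have n₃ : t₃ ≠ t₁ := by omega
  have n₄ : t₄ ≠ t₁ := by omega
  have em₂ := em t₂
  have ez₂ := ez t₂
  have ez₃ := ez t₃
  have ez₄ := ez t₄
  have hmt : t₂ ∉ L → (t₂ ∈ Q → False) → m = t₂ := by
    intro hl hq
    have h := hC t₂
    rcases hF t₂ h₂ n₂ with f | f | f | f | f
    · exact absurd f.2 hl
    · exact absurd f.2.2.2 hq
    · exact f.2.symm
    · omega
    · omega
  constructor
  · rintro (⟨t, ht, hlL, hlQ⟩ | ⟨hc, hq | ⟨t, ht, hlL⟩⟩)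
    · have g := hCP t ht
      have ft := hle t g.1
      have gt := hC t ht
      have hm := hmt (fun h => by have := hlL _ h; omega) (fun h => by have := hlQ _ h; omega)
      have em₂ := em₂ hm
      have hz : z = t₃ := by
        have l₃ := hlL t₃
        have q₃ := hlQ t₃
        have c₃ := hC t₃
        rcases hF t₃ h₃ n₃ with f | f | f | f | f
        · have := l₃ f.2; omega
        · have := q₃ f.2.2.2; omega
        · omega
        · omega
        · exact f.2.symm
      have ez₃ := ez₃ hz
      have ht₄ : L.length + (Q.length + 1) < P.idxOf t₄ := by
        have l₄ := hlL t₄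
        have q₄ := hlQ t₄
        have i₄ := hinj t g.1 t₄
        rcases hF t₄ h₄ n₄ with f | f | f | f | f
        · have := l₄ f.2; omega
        · have := q₄ f.2.2.2; omega
        · omega
        · exact f.1
        · omega
      exact Or.inr (Or.inr (Or.inr (Or.inr (Or.inr (Or.inr (by omega))))))
    · left
      omega
    · have g := hQP t ht
      have ft := hle t g.1
      have gt := hQ t ht
      have hm : m = t₂ := hmt (fun h => by have := hlL _ h; omega) (fun h => by
        have := hQ _ h
        omega)
      have em₂ := em₂ hm
      by_cases hz : z = t₃
      · have ez₃ := ez₃ hz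
        have ht₄ : L.length < P.idxOf t₄ := by
          have i₄ := hinj t g.1 t₄
          have i₃ := hinj t g.1 t₃
          by_contra! hcon
          rcases hF t₄ h₄ n₄ with f | f | f | f | f
          · have := hlL _ f.2
            omega
          all_goals omega
        exact Or.inr (Or.inr (Or.inr (Or.inr (Or.inl (by omega)))))
      · have ht₃ : L.length < P.idxOf t₃ := by
          have i₃ := hinj t g.1 t₃
          by_contra! hcon
          rcases hF t₃ h₃ n₃ with f | f | f | f | f
          · have := hlL _ f.2
            omega
          all_goals omega
        refine Or.inr (Or.inr (Or.inr (Or.inr (Or.inr (Or.inl ⟨by omega, by omega, ?_⟩)))))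
        rcases hF t₃ h₃ n₃ with f | f | f | f | f <;> omega
  · intro h
    have hcase : (C.length = 0 ∧ Q.length = 0) ∨ (C.length = 0 ∧ m = t₂ ∧ z = t₃ ∧ t₄ ∈ Q) ∨
        (C.length = 0 ∧ m = t₂ ∧ t₃ ∈ Q) ∨ (m = t₂ ∧ z = t₃ ∧ t₄ ∈ C) := by
      have k₂ : P.idxOf t₂ ≤ L.length + (Q.length + 1) := by
        rcases hF t₂ h₂ n₂ with f | f | f | f | f <;> omega
      have k₂' : P.idxOf t₂ = L.length + (Q.length + 1) → m = t₂ := by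
        rcases hF t₂ h₂ n₂ with f | f | f | f | f <;> omega
      have k₃ : P.idxOf t₃ + 1 = P.length → z = t₃ := by
        rcases hF t₃ h₃ n₃ with f | f | f | f | f <;> omega
      have k₄ : P.idxOf t₁ < P.idxOf t₄ → m = t₂ → z = t₃ → t₄ ∈ C ∨ t₄ ∈ Q := by
        intro _ _ _
        rcases hF t₄ h₄ n₄ with f | f | f | f | f
        · omega
        · exact Or.inr f.2.2.2
        · omega
        · exact Or.inl f.2.2.2
        · omega
      rcases h with h | h | h | h | h | h | h
      · exact Or.inl (by omega)
      · omega
      · omega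
      · have hz := k₃ h.1
        omega
      · have hm := k₂' (by omega)
        have hz := k₃ h.1
        rcases k₄ h.2.2 hm hz with h4 | h4
        · exact Or.inr (Or.inr (Or.inr ⟨hm, hz, h4⟩))
        · exact Or.inr (Or.inl ⟨by omega, hm, hz, h4⟩)
      · have hm := k₂' (by omega)
        refine Or.inr (Or.inr (Or.inl ⟨by omega, hm, ?_⟩))
        rcases hF t₃ h₃ n₃ with f | f | f | f | f
        · omega
        · exact f.2.2.2
        all_goals omega
      · have hz := k₃ h.1
        have hm : m = t₂ := by omega
        have em₂ := em₂ hm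
        rcases k₄ (by omega) hm hz with h4 | h4
        · exact Or.inr (Or.inr (Or.inr ⟨hm, hz, h4⟩))
        · have := hQP t₄ h4
          omega
    have hLz : ∀ x ∈ L, x ≠ t₁ ∧ x ≠ m ∧ x ≠ z := by
      intro x hx
      have hxP := hLP x hx
      have h1 := (hloc x hxP).1.1 hx
      have h2 := fun h => (hlocm x hxP).2.1.1 h
      have h3 := fun h => (hlocz x hxP).2.1.1 h
      exact ⟨(hL x hx).ne, fun h => by have := h2 h; omega, fun h => by have := h3 h; omega⟩
    rcases hcase with h | ⟨hc, hm, hz, h4⟩ | ⟨hc, hm, h3⟩ | ⟨hm, hz, h4⟩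
    · exact Or.inr ⟨h.1, Or.inl h.2⟩
    · refine Or.inr ⟨hc, Or.inr ⟨t₄, h4, fun x hx => ?_⟩⟩
      have h1 := hle x (hLP x hx)
      have h2 := hLz x hx
      have h5 := (hloc x (hLP x hx)).1.1 hx
      have h6 := (hQP t₄ h4).2.1
      have h7 := hinj x (hLP x hx) t₄
      omega
    · refine Or.inr ⟨hc, Or.inr ⟨t₃, h3, fun x hx => ?_⟩⟩
      have h1 := hle x (hLP x hx)
      have h2 := hLz x hx
      have h5 := (hloc x (hLP x hx)).1.1 hx
      have h6 := (hQP t₃ h3).2.1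
      have h7 := hinj x (hLP x hx) t₃
      omega
    · refine Or.inl ⟨t₄, h4, fun x hx => ?_, fun x hx => ?_⟩
      · have h1 := hle x (hLP x hx)
        have h2 := hLz x hx
        have h5 := (hloc x (hLP x hx)).1.1 hx
        have h6 := (hCP t₄ h4).2.1
        have h7 := hinj x (hLP x hx) t₄
        omega
      · have hx' := hQP x hx
        have h1 := hle x hx'.1
        have h2 := hQ x hx
        have h3 := ez₃ hz
        have h6 := (hCP t₄ h4).2.1
        have h7 := hinj x hx'.1 t₄
        have h8 := hinj x hx'.1 t₃
        have h9 := hR x (by simp [hx])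
        omega

/-- With slack `2`, in terms of the places of the five greatest letters. -/
theorem slow_two_iff {P : List ℕ} (hnd : P.Nodup) {t₁ t₂ t₃ t₄ t₅ : ℕ} (h₁ : t₁ ∈ P)
    (h₂ : t₂ ∈ P) (h₃ : t₃ ∈ P) (h₄ : t₄ ∈ P) (h₅ : t₅ ∈ P) (h₁₂ : t₂ < t₁) (h₂₃ : t₃ < t₂)
    (h₃₄ : t₄ < t₃) (h₄₅ : t₅ < t₄)
    (hle : ∀ x ∈ P, x = t₁ ∨ x = t₂ ∨ x = t₃ ∨ x = t₄ ∨ x ≤ t₅) :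
    Slow 2 P ↔ SlowTwoShape P.length (P.idxOf t₁) (P.idxOf t₂) (P.idxOf t₃) (P.idxOf t₄)
      (P.idxOf t₅) := by
  obtain ⟨L, M, R, hP, hL, hR⟩ := exists_split hnd (List.ne_nil_of_mem h₁)
  have hnd' := hP ▸ hnd
  have hLn := hnd'.of_append_left
  have hRn := hnd'.of_append_right.of_cons
  have hLR : (L ++ R).Nodup := hnd'.sublist ((List.sublist_cons_self M R).append_left L)
  have hlt : ∀ x ∈ P, P.idxOf x < P.length := fun x => List.idxOf_lt_length_of_mem
  have hloc := fun x hx => mem_iff_idxOf (x := x) hP hnd hx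
  have hMP : M ∈ P := by simp [hP]
  have hltM : ∀ x ∈ P, x = M ∨ x < M := fun x hx => by
    rw [hP] at hx
    rcases List.mem_append.1 hx with h | h
    · exact Or.inr (hL x h)
    · rcases List.mem_cons.1 h with h | h
      · exact Or.inl h
      · exact Or.inr (hR x h)
  have hlen : P.length = L.length + 1 + R.length := by rw [hP]; simp; omega
  have hM : M = t₁ := by
    have := hltM t₁ h₁
    have := hle M hMP
    omega
  subst hM
  have i₁ := (hloc M hMP).2.1.1 rfl
  have n₂₃ := idxOf_ne_of_mem h₂ h₂₃.ne'
  have n₃₄ := idxOf_ne_of_mem h₃ h₃₄.ne'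
  have n₄₅ := idxOf_ne_of_mem h₄ h₄₅.ne'
  have n₂₄ := idxOf_ne_of_mem h₂ (h₃₄.trans h₂₃).ne'
  have n₂₅ := idxOf_ne_of_mem h₂ (h₄₅.trans (h₃₄.trans h₂₃)).ne'
  have n₃₅ := idxOf_ne_of_mem h₃ (h₄₅.trans h₃₄).ne'
  have hLP : ∀ x ∈ L, x ∈ P := fun x hx => by simp [hP, hx]
  rcases eq_or_ne R [] with rfl | hR0
  · have := slow_zero_concat hnd' hL
    rw [← hP] at this
    refine iff_of_true (fun j hj => (this j hj).trans (by omega)) (Or.inl ?_)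
    simp only [List.length_nil] at hlen
    omega
  -- `R = Q m` leaves `S(L) S(Q)` with slack `1`, and `R = Q m B` leaves slack at most `0`
  rcases concat_or_append_cons hRn hR0 with ⟨Q, m, hRQ, hQ, hp⟩ | ⟨Q, m, B, hRQ, hB0, hQ, hB, hp⟩
  · unfold SlowTwoShape
    have hQn := (hRQ ▸ hRn).of_append_left
    have hS : Slow 2 P ↔ Slow 1 (stackSort L ++ stackSort Q) := by
      rw [← hp, hP]
      refine slow_append_cons_iff_of_length (s := 1) (d := 0) hnd' hL hR ?_
      rw [hp, length_stackSort hQn, hRQ]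
      simp
    rw [hS]
    have hlen' : R.length = Q.length + 1 := by simp [hRQ]
    have hLQn : (L ++ Q).Nodup := by
      refine hLR.sublist ?_
      rw [hRQ]
      exact (List.sublist_append_left Q [m]).append_left L
    have hloc' := fun x hx =>
      mem_iff_idxOf (x := x) (P := P) (L := L ++ M :: Q) (m := m) (R := []) (by simp [hP, hRQ])
        hnd hx
    have hmP : m ∈ P := by simp [hP, hRQ]
    have hLQ : ∀ x ∈ P, x ∈ L ++ Q ↔ x ≠ M ∧ x ≠ m := by
      intro x hx
      have h1 := (hloc x hx)
      have h2 := (hloc' x hx)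
      have h3 : x ∈ P ↔ x ∈ L ∨ x = M ∨ x ∈ Q ∨ x = m := by simp [hP, hRQ]
      have h4 := fun h : x ∈ L => (hL x h).ne
      have h5 := fun h : x ∈ Q => (hR x (by simp [hRQ, h])).ne
      have h6 := fun h : x ∈ Q => (hQ x h).ne
      have h7 : m ∉ L := fun h =>
        (List.nodup_append.1 hLR).2.2 m h m (by simp [hRQ]) rfl
      rw [List.mem_append]
      grind
    have hLQP : ∀ x ∈ L ++ Q, x ∈ P := fun x hx => by
      rcases List.mem_append.1 hx with h | h <;> simp [hP, hRQ, h]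
    have hQ' : ∀ x ∈ P, x ∈ Q ↔ L.length < P.idxOf x ∧ P.idxOf x < L.length + 1 + Q.length := by
      intro x hx
      have h1 := (hloc x hx).2.2
      have h2 := (hloc' x hx).2.1
      have h3 := hlt x hx
      have h4 : x ∈ R ↔ x ∈ Q ∨ x = m := by simp [hRQ]
      have h5 : x ∈ Q → x ≠ m := fun h => (hQ x h).ne
      simp only [List.length_append, List.length_cons] at h2
      grind
    have hF : ∀ x ∈ P, x ≠ M → P.idxOf x < L.length ∨
        (L.length < P.idxOf x ∧ P.idxOf x < L.length + 1 + Q.length ∧ x < m) ∨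
        (P.idxOf x = L.length + 1 + Q.length ∧ x = m) := by
      intro x hx hxM
      have h1 := hlt x hx
      have h2 : P.idxOf x ≠ L.length := fun h => hxM ((hloc x hx).2.1.2 h)
      have h3 := fun h h' => hQ x ((hQ' x hx).2 ⟨h, h'⟩)
      have h4 := (hloc' x hx).2.1.2
      simp only [List.length_append, List.length_cons] at h4
      rcases (by omega : P.idxOf x < L.length ∨
        (L.length < P.idxOf x ∧ P.idxOf x < L.length + 1 + Q.length) ∨
        P.idxOf x = L.length + (Q.length + 1)) with h | h | h
      · exact Or.inl h
      · exact Or.inr (Or.inl ⟨h.1, h.2, h3 h.1 h.2⟩)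
      · exact Or.inr (Or.inr ⟨by omega, h4 h⟩)
    have f₂ := hF t₂ h₂ (by omega)
    have f₃ := hF t₃ h₃ (by omega)
    have f₄ := hF t₄ h₄ (by omega)
    have f₅ := hF t₅ h₅ (by omega)
    have im := (hloc' m hmP).2.1.1 rfl
    simp only [List.length_append, List.length_cons] at im
    have em : ∀ t, m = t → P.idxOf t = L.length + 1 + Q.length := by
      rintro t rfl
      omega
    have e₂ := em t₂
    have e₃ := em t₃
    have e₄ := em t₄
    have e₅ := em t₅
    have hmle := hle m hmP
    have hmM := hR m (by simp [hRQ])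
    have hU : ∀ u₁ u₂ u₃, u₁ ∈ P → u₂ ∈ P → u₃ ∈ P → u₂ < u₁ → u₃ < u₂ → u₁ < M → u₁ ≠ m →
        u₂ ≠ m → u₃ ≠ m →
        (∀ x, x = M ∨ x = t₂ ∨ x = t₃ ∨ x = t₄ ∨ x ≤ t₅ → x < M → x ≠ m →
          x = u₁ ∨ x = u₂ ∨ x ≤ u₃) →
        (Slow 1 (stackSort L ++ stackSort Q) ↔ Q.length ≤ 1 ∨
          (L.length < P.idxOf u₁ ∧ P.idxOf u₁ < L.length + 1 + Q.length) ∨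
          ((L.length < P.idxOf u₂ ∧ P.idxOf u₂ < L.length + 1 + Q.length) ∧
            (L.length < P.idxOf u₃ ∧ P.idxOf u₃ < L.length + 1 + Q.length))) := by
      intro u₁ u₂ u₃ m₁ m₂ m₃ h12 h23 h1M n₁ n₂ n₃ hu
      rw [← hQ' u₁ m₁, ← hQ' u₂ m₂, ← hQ' u₃ m₃]
      refine slow_one_stackSort_append_stackSort_iff hLQn ((hLQ _ m₁).2 ⟨h1M.ne, n₁⟩)
        ((hLQ _ m₂).2 ⟨by omega, n₂⟩) ((hLQ _ m₃).2 ⟨by omega, n₃⟩) h12 h23 fun x hx => ?_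
      have hxP := hLQP x hx
      have h1 := (hLQ x hxP).1 hx
      have h2 := hltM x hxP
      exact hu x (hle x hxP) (by omega) h1.2
    -- the three greatest letters of `S(L) S(Q)` are those of `t₂, …, t₅` that are not `m`
    rcases (by omega : m = t₂ ∨ m = t₃ ∨ m = t₄ ∨ m < t₄) with hm | hm | hm | hm
    · rw [hU t₃ t₄ t₅ h₃ h₄ h₅ h₃₄ h₄₅ (by omega) (by omega) (by omega) (by omega)
        (fun x _ _ _ => by omega)]
      rw [hlen'] at hlen
      clear * - f₂ f₃ f₄ f₅ e₂ e₃ e₄ e₅ hm hlen i₁ n₂₃ n₂₄ n₂₅ n₃₄ n₃₅ n₄₅ h₁₂ h₂₃ h₃₄ h₄₅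
      generalize P.length = N at *
      generalize P.idxOf M = p₁, P.idxOf t₂ = p₂, P.idxOf t₃ = p₃, P.idxOf t₄ = p₄,
        P.idxOf t₅ = p₅ at *
      generalize L.length = l, Q.length = q at *
      grind
    · rw [hU t₂ t₄ t₅ h₂ h₄ h₅ (by omega) h₄₅ (by omega) (by omega) (by omega) (by omega)
        (fun x _ _ _ => by omega)]
      rw [hlen'] at hlen
      clear * - f₂ f₃ f₄ f₅ e₂ e₃ e₄ e₅ hm hlen i₁ n₂₃ n₂₄ n₂₅ n₃₄ n₃₅ n₄₅ h₁₂ h₂₃ h₃₄ h₄₅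
      generalize P.length = N at *
      generalize P.idxOf M = p₁, P.idxOf t₂ = p₂, P.idxOf t₃ = p₃, P.idxOf t₄ = p₄,
        P.idxOf t₅ = p₅ at *
      generalize L.length = l, Q.length = q at *
      grind
    · rw [hU t₂ t₃ t₅ h₂ h₃ h₅ h₂₃ (by omega) (by omega) (by omega) (by omega) (by omega)
        (fun x _ _ _ => by omega)]
      rw [hlen'] at hlen
      clear * - f₂ f₃ f₄ f₅ e₂ e₃ e₄ e₅ hm hlen i₁ n₂₃ n₂₄ n₂₅ n₃₄ n₃₅ n₄₅ h₁₂ h₂₃ h₃₄ h₄₅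
      generalize P.length = N at *
      generalize P.idxOf M = p₁, P.idxOf t₂ = p₂, P.idxOf t₃ = p₃, P.idxOf t₄ = p₄,
        P.idxOf t₅ = p₅ at *
      generalize L.length = l, Q.length = q at *
      grind
    · rw [hU t₂ t₃ t₄ h₂ h₃ h₄ h₂₃ h₃₄ (by omega) (by omega) (by omega) (by omega)
        (fun x _ _ _ => by omega)]
      rw [hlen'] at hlen
      clear * - f₂ f₃ f₄ f₅ e₂ e₃ e₄ e₅ hm hlen i₁ n₂₃ n₂₄ n₂₅ n₃₄ n₃₅ n₄₅ h₁₂ h₂₃ h₃₄ h₄₅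
      generalize P.length = N at *
      generalize P.idxOf M = p₁, P.idxOf t₂ = p₂, P.idxOf t₃ = p₃, P.idxOf t₄ = p₄,
        P.idxOf t₅ = p₅ at *
      generalize L.length = l, Q.length = q at *
      grind
  · have hBn := (hRQ ▸ hRn).of_append_right.of_cons
    have hQn := (hRQ ▸ hRn).of_append_left
    have hmP : m ∈ P := by simp [hP, hRQ]
    have hmle := hle m hmP
    have hmM := hR m (by simp [hRQ])
    have hlocm := fun x hx =>
      mem_iff_idxOf (x := x) (P := P) (L := L ++ M :: Q) (m := m) (R := B) (by simp [hP, hRQ])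
        hnd hx
    simp only [List.length_append, List.length_cons] at hlocm
    have hlen' : R.length = Q.length + 1 + B.length := by simp [hRQ]; omega
    -- with a fourth right-to-left maximum, `popped` removes more than the slack allows
    rcases concat_or_append_cons hBn hB0 with
      ⟨C, z, hBC, hC, hp'⟩ | ⟨C, y, D, hBC, hD0, hC, hD, hp'⟩
    · have hlen'' : B.length = C.length + 1 := by simp [hBC]
      have hzP : z ∈ P := by simp [hP, hRQ, hBC]
      have hzle := hle z hzP
      have hzm := hB z (by simp [hBC])
      have hlocz := fun x hx =>
        mem_iff_idxOf (x := x) (P := P) (L := L ++ M :: (Q ++ m :: C)) (m := z) (R := [])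
          (by simp [hP, hRQ, hBC]) hnd hx
      simp only [List.length_append, List.length_cons] at hlocz
      have hCn := (hBC ▸ hBn).of_append_left
      have hS : Slow 2 P ↔ Slow 0 (stackSort L ++ (stackSort Q ++ stackSort C)) := by
        rw [← hp', ← hp, hP]
        refine slow_append_cons_iff_of_length (s := 0) (d := 1) hnd' hL hR ?_
        rw [hp, hp', List.length_append, length_stackSort hCn, length_stackSort hQn]
        omega
      have hsub : (L ++ (Q ++ C)).Nodup := by
        refine hLR.sublist (List.Sublist.append_left ?_ L)
        rw [hRQ, hBC]
        exact ((List.sublist_append_left C [z]).trans (List.sublist_cons_self _ _)).append_left Q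
      have hS' : Slow 2 P ↔ (∃ t ∈ C, (∀ x ∈ L, x < t) ∧ ∀ x ∈ Q, x < t) ∨
          (C.length = 0 ∧ (Q.length = 0 ∨ ∃ t ∈ Q, ∀ x ∈ L, x < t)) := by
        rw [hS]
        rcases eq_or_ne C [] with rfl | hC0
        · rw [stackSort_nil, List.append_nil]
          rcases eq_or_ne Q [] with rfl | hQ0
          · rw [stackSort_nil, List.append_nil]
            exact iff_of_true (slow_zero_stackSort hLn) (by simp)
          · have hLQ : (stackSort L ++ Q).Nodup := by
              refine ((stackSort_perm hLn).append_right Q).nodup_iff.2 ?_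
              simpa using hsub
            rw [slow_zero_append_stackSort_iff hLQ hQ0]
            simp [mem_stackSort hLn, hQ0]
        · have hLQC : ((stackSort L ++ stackSort Q) ++ C).Nodup := by
            refine (((stackSort_perm hLn).append (stackSort_perm hQn)).append_right C).nodup_iff.2
              ?_
            simpa using hsub
          rw [← List.append_assoc, slow_zero_append_stackSort_iff hLQC hC0]
          simp [mem_stackSort hLn, mem_stackSort hQn, hC0, or_imp, forall_and]
      rw [hS']
      exact slowTwoShape_iff_of_eq hnd (by rw [hP, hRQ, hBC]) hL (by rw [← hBC, ← hRQ]; exact hR)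
        hQ hzm hC h₁ h₂ h₃ h₄ h₁₂ h₂₃ h₃₄ h₄₅ hle
    · unfold SlowTwoShape
      refine iff_of_false ?_ ?_
      · intro h
        rw [hP] at h
        have h1 := length_le_of_slow_append_cons hnd' hL hR h
        have h2 := length_popped_lt (hBC ▸ hBn).of_append_right.of_cons hD0
        rw [hp, hp'] at h1
        simp only [hRQ, hBC, List.length_append, List.length_cons, length_stackSort hQn,
          length_stackSort (hBC ▸ hBn).of_append_left] at h1
        omega
      · have hDl := List.length_pos_iff.2 hD0
        have hlen'' : B.length = C.length + 1 + D.length := by simp [hBC]; omega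
        have hyP : y ∈ P := by simp [hP, hRQ, hBC]
        have hyle := hle y hyP
        have hym := hB y (by simp [hBC])
        have hlocy := fun x hx =>
          mem_iff_idxOf (x := x) (P := P) (L := L ++ M :: (Q ++ m :: C)) (m := y) (R := D)
            (by simp [hP, hRQ, hBC]) hnd hx
        simp only [List.length_append, List.length_cons] at hlocy
        have hF : ∀ x ∈ P, x ≠ M → P.idxOf x < L.length ∨
            (L.length < P.idxOf x ∧ P.idxOf x < L.length + (Q.length + 1)) ∨
            (P.idxOf x = L.length + (Q.length + 1) ∧ x = m) ∨
            (L.length + (Q.length + 1) < P.idxOf x ∧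
              P.idxOf x < L.length + (Q.length + (C.length + 1) + 1) ∧ x < m) ∨
            (P.idxOf x = L.length + (Q.length + (C.length + 1) + 1) ∧ x = y) ∨
            (L.length + (Q.length + (C.length + 1) + 1) < P.idxOf x ∧ x < y) := by
          intro x hx hxM
          have h1 : P.idxOf x ≠ L.length := fun h => hxM ((hloc x hx).2.1.2 h)
          have h2 := (hlocm x hx).2.1.2
          have h3 := (hlocy x hx).2.1.2
          have h4 := fun h => hB x ((hlocm x hx).2.2.2 h)
          have h5 := fun h => hD x ((hlocy x hx).2.2.2 h)
          clear * - h1 h2 h3 h4 h5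
          grind
        have f₂ := hF t₂ h₂ (by omega)
        have f₃ := hF t₃ h₃ (by omega)
        have em : ∀ t, m = t → P.idxOf t = L.length + (Q.length + 1) := by
          rintro t rfl
          exact (hlocm m hmP).2.1.1 rfl
        have ey : ∀ t, y = t → P.idxOf t = L.length + (Q.length + (C.length + 1) + 1) := by
          rintro t rfl
          exact (hlocy y hyP).2.1.1 rfl
        have em₂ := em t₂
        have ey₃ := ey t₃
        have b₂ := hlt t₂ h₂
        have b₃ := hlt t₃ h₃
        rw [hlen', hlen''] at hlen
        have k₂ : P.idxOf t₂ ≤ L.length + (Q.length + 1) := by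
          rcases f₂ with f | f | f | f | f | f <;> omega
        have k₃ : P.idxOf t₃ ≤ L.length + (Q.length + (C.length + 1) + 1) := by
          rcases f₃ with f | f | f | f | f | f <;> omega
        clear f₂ f₃ hyle hmle em₂ ey₃ hF
        omega

/-! ### Permutations that need `n - 3` passes -/

theorem length_takeWhile_ne (v : List ℕ) (a : ℕ) : (v.takeWhile (· ≠ a)).length = v.idxOf a := by
  induction v with
  | nil => simp
  | cons x v ih =>
    by_cases h : x = a
    · simp [h]
    · rw [List.takeWhile_cons_of_pos (by simpa using h), List.length_cons, ih,
        List.idxOf_cons_ne _ h]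

theorem mem_takeWhile_ne_iff (v : List ℕ) (a x : ℕ) :
    x ∈ v.takeWhile (· ≠ a) ↔ v.idxOf x < v.idxOf a := by
  induction v with
  | nil => simp
  | cons y v ih =>
    by_cases h : y = a
    · simp [h]
    · rw [List.takeWhile_cons_of_pos (by simpa using h), List.idxOf_cons_ne _ h, List.mem_cons, ih]
      by_cases hx : y = x
      · subst hx
        simp
      · rw [List.idxOf_cons_ne _ hx]
        simp [Ne.symm hx]

theorem idxOf_takeWhile_ne {v : List ℕ} {a x : ℕ} (h : v.idxOf x < v.idxOf a) :
    (v.takeWhile (· ≠ a)).idxOf x = v.idxOf x := by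
  have hx := (mem_takeWhile_ne_iff v a x).2 h
  conv_rhs => rw [← List.takeWhile_append_dropWhile (p := (· ≠ a)) (l := v)]
  rw [List.idxOf_append_of_mem hx]

/-- Deleting the letters less than `a` does not change the inversions at `a`, which then form the
whole part before `a`. -/
theorem inversionsAt_eq (a : ℕ) (w : List ℕ) :
    inversionsAt a w = (w.filter (a ≤ ·)).takeWhile (· ≠ a) := by
  unfold inversionsAt
  induction w with
  | nil => simp
  | cons x w ih =>
    rcases lt_trichotomy x a with h | h | h
    · rw [List.takeWhile_cons_of_pos (by simpa using h.ne),
        List.filter_cons_of_neg (by simpa using h.le), ih,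
        List.filter_cons_of_neg (by simpa using h)]
    · subst h
      simp
    · rw [List.takeWhile_cons_of_pos (by simpa using h.ne'),
        List.filter_cons_of_pos (by simpa using h), ih,
        List.filter_cons_of_pos (by simpa using h.le),
        List.takeWhile_cons_of_pos (by simpa using h.ne')]

/-- Deleting the letter `b` moves the letters after it one place to the left. -/
theorem idxOf_filter_ne {v : List ℕ} (hv : v.Nodup) {b x : ℕ} (hx : x ≠ b) (hb : b ∈ v)
    (hxv : x ∈ v) :
    (v.filter (· ≠ b)).idxOf x = if v.idxOf b < v.idxOf x then v.idxOf x - 1 else v.idxOf x := by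
  induction v with
  | nil => simp at hb
  | cons y v ih =>
    have hyv := (List.nodup_cons.1 hv).1
    by_cases hyb : y = b
    · subst hyb
      have h1 : v.filter (· ≠ y) = v := by
        rw [List.filter_eq_self]
        intro z hz
        simpa using fun h : z = y => hyv (h ▸ hz)
      rw [List.filter_cons_of_neg (by simp), h1, List.idxOf_cons_self, List.idxOf_cons_ne _ hx.symm]
      simp
    · have hb' : b ∈ v := by grind
      rw [List.filter_cons_of_pos (by simpa using hyb), List.idxOf_cons_ne _ hyb]
      by_cases hyx : y = x
      · subst hyx
        simp
      · have hx' : x ∈ v := by grind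
        rw [List.idxOf_cons_ne _ hyx, List.idxOf_cons_ne _ hyx, ih hv.of_cons hb' hx']
        split_ifs <;> omega

section Perms

variable {n : ℕ} {w : List ℕ}

theorem length_filter_le_of_mem_perms (hw : w ∈ perms n) (a : ℕ) :
    (w.filter (a ≤ ·)).length ≤ n + 1 - a := by
  have hs : w.filter (a ≤ ·) ⊆ List.range' a (n + 1 - a) := by
    intro x hx
    rw [List.mem_filter, mem_iff_of_mem_perms hw] at hx
    rw [List.mem_range'_1]
    have := of_decide_eq_true hx.2
    omega
  have := (((nodup_of_mem_perms hw).filter _).subperm hs).length_le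
  rwa [List.length_range'] at this

theorem filter_one_le (hw : w ∈ perms n) : w.filter (1 ≤ ·) = w := by
  rw [List.filter_eq_self]
  intro x hx
  simpa using ((mem_iff_of_mem_perms hw).1 hx).1

theorem filter_succ_le (w : List ℕ) (a : ℕ) :
    w.filter (a + 1 ≤ ·) = (w.filter (a ≤ ·)).filter (· ≠ a) := by
  rw [List.filter_filter]
  refine List.filter_congr fun x _ => ?_
  rw [← Bool.decide_and]
  exact decide_eq_decide.2 (by omega)

theorem length_inversionsAt (a : ℕ) (w : List ℕ) :
    (inversionsAt a w).length = (w.filter (a ≤ ·)).idxOf a := by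
  rw [inversionsAt_eq, length_takeWhile_ne]

theorem mem_inversionsAt_iff (a x : ℕ) (w : List ℕ) :
    x ∈ inversionsAt a w ↔ (w.filter (a ≤ ·)).idxOf x < (w.filter (a ≤ ·)).idxOf a := by
  rw [inversionsAt_eq, mem_takeWhile_ne_iff]

theorem idxOf_inversionsAt {a x : ℕ} {w : List ℕ} (h : x ∈ inversionsAt a w) :
    (inversionsAt a w).idxOf x = (w.filter (a ≤ ·)).idxOf x := by
  rw [mem_inversionsAt_iff] at h
  rw [inversionsAt_eq, idxOf_takeWhile_ne h]

theorem lt_and_mem_of_mem_inversionsAt {a x : ℕ} {w : List ℕ} (h : x ∈ inversionsAt a w) :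
    a < x ∧ x ∈ w := by
  have := List.mem_filter.1 h
  exact ⟨of_decide_eq_true this.2, (List.takeWhile_sublist _).subset this.1⟩

/-- There are at most `n - a` inversions at `a`, so that only those at `1`, `2` and `3` can take
`n - 3` passes or more to disappear, and their number less the number of passes is the slack. -/
theorem mem_exactly_iff_slow (hn : 6 ≤ n) (hw : w ∈ perms n) :
    w ∈ exactly n (n - 3) ↔
      (((inversionsAt 1 w).length + 1 = n ∧ Slow 2 (inversionsAt 1 w)) ∨
        ((inversionsAt 1 w).length + 2 = n ∧ Slow 1 (inversionsAt 1 w)) ∨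
        ((inversionsAt 1 w).length + 3 = n ∧ Slow 0 (inversionsAt 1 w)) ∨
        ((inversionsAt 2 w).length + 2 = n ∧ Slow 1 (inversionsAt 2 w)) ∨
        ((inversionsAt 2 w).length + 3 = n ∧ Slow 0 (inversionsAt 2 w)) ∨
        ((inversionsAt 3 w).length + 3 = n ∧ Slow 0 (inversionsAt 3 w))) ∧
      ¬ (((inversionsAt 1 w).length + 1 = n ∧ Slow 1 (inversionsAt 1 w)) ∨
        ((inversionsAt 1 w).length + 2 = n ∧ Slow 0 (inversionsAt 1 w)) ∨
        ((inversionsAt 2 w).length + 2 = n ∧ Slow 0 (inversionsAt 2 w))) := by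
  have hlen : ∀ a ∈ w, (inversionsAt a w).length ≤ n - a := by
    intro a ha
    have h1 : a ∈ w.filter (a ≤ ·) := List.mem_filter.2 ⟨ha, by simp⟩
    have h2 := List.idxOf_lt_length_of_mem h1
    have h3 := length_filter_le_of_mem_perms hw a
    rw [length_inversionsAt]
    omega
  have hnil : ∀ k a, (inversionsAt a w).length ≤ k → popped^[k] (inversionsAt a w) = [] :=
    fun k a h => iterate_popped_eq_nil (nodup_inversionsAt (nodup_of_mem_perms hw) a) h
  have hmem : ∀ a, 1 ≤ a → a ≤ n → a ∈ w := fun a h h' => (mem_iff_of_mem_perms hw).2 ⟨h, h'⟩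
  have h1 := hlen 1 (hmem 1 (by omega) (by omega))
  have h2 := hlen 2 (hmem 2 (by omega) (by omega))
  have h3 := hlen 3 (hmem 3 (by omega) (by omega))
  have key : ∀ a k s, (inversionsAt a w).length ≤ k + 1 + s →
      (popped^[k] (inversionsAt a w) ≠ [] ↔ ∃ i ≤ s, (inversionsAt a w).length = k + 1 + i ∧
        Slow i (inversionsAt a w)) := by
    intro a k s hs
    constructor
    · intro h
      have : k < (inversionsAt a w).length := by
        by_contra! hle
        exact h (hnil k a hle)
      refine ⟨(inversionsAt a w).length - (k + 1), by omega, by omega, ?_⟩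
      exact (iterate_popped_ne_nil_iff (by omega)).1 h
    · rintro ⟨i, -, hi, hs⟩
      exact (iterate_popped_ne_nil_iff hi).2 hs
  obtain ⟨m, rfl⟩ : ∃ m, n = m + 4 := ⟨n - 4, by omega⟩
  rw [show m + 4 - 3 = m + 1 by omega, mem_exactly_succ_iff hw, and_comm]
  refine and_congr ?_ ?_
  · have : (∃ a ∈ w, popped^[m] (inversionsAt a w) ≠ []) ↔
        popped^[m] (inversionsAt 1 w) ≠ [] ∨ popped^[m] (inversionsAt 2 w) ≠ [] ∨
          popped^[m] (inversionsAt 3 w) ≠ [] := by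
      constructor
      · rintro ⟨a, ha, h⟩
        have ha' := (mem_iff_of_mem_perms hw).1 ha
        have : a < 4 := by
          by_contra! h4
          exact h (hnil m a ((hlen a ha).trans (by omega)))
        have ha₁ := ha'.1
        interval_cases a <;> simp [h]
      · rintro (h | h | h)
        · exact ⟨1, hmem 1 (by omega) (by omega), h⟩
        · exact ⟨2, hmem 2 (by omega) (by omega), h⟩
        · exact ⟨3, hmem 3 (by omega) (by omega), h⟩
    rw [this, key 1 m 2 (by omega), key 2 m 1 (by omega), key 3 m 0 (by omega)]
    constructor
    · rintro (⟨i, hi, hl, h⟩ | ⟨i, hi, hl, h⟩ | ⟨i, hi, hl, h⟩) <;> interval_cases i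
      · exact Or.inr (Or.inr (Or.inl ⟨by omega, h⟩))
      · exact Or.inr (Or.inl ⟨by omega, h⟩)
      · exact Or.inl ⟨by omega, h⟩
      · exact Or.inr (Or.inr (Or.inr (Or.inr (Or.inl ⟨by omega, h⟩))))
      · exact Or.inr (Or.inr (Or.inr (Or.inl ⟨by omega, h⟩)))
      · exact Or.inr (Or.inr (Or.inr (Or.inr (Or.inr ⟨by omega, h⟩))))
    · rintro (⟨hl, h⟩ | ⟨hl, h⟩ | ⟨hl, h⟩ | ⟨hl, h⟩ | ⟨hl, h⟩ | ⟨hl, h⟩)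
      · exact Or.inl ⟨2, by omega, by omega, h⟩
      · exact Or.inl ⟨1, by omega, by omega, h⟩
      · exact Or.inl ⟨0, by omega, by omega, h⟩
      · exact Or.inr (Or.inl ⟨1, by omega, by omega, h⟩)
      · exact Or.inr (Or.inl ⟨0, by omega, by omega, h⟩)
      · exact Or.inr (Or.inr ⟨0, by omega, by omega, h⟩)
  · have : (∀ a ∈ w, popped^[m + 1] (inversionsAt a w) = []) ↔
        ¬ (popped^[m + 1] (inversionsAt 1 w) ≠ [] ∨ popped^[m + 1] (inversionsAt 2 w) ≠ []) := by
      constructor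
      · intro h
        simp [h 1 (hmem 1 (by omega) (by omega)), h 2 (hmem 2 (by omega) (by omega)),
          -Function.iterate_succ]
      · intro h a ha
        have ha' := (mem_iff_of_mem_perms hw).1 ha
        rcases le_or_gt 3 a with h3 | h3
        · exact hnil _ a ((hlen a ha).trans (by omega))
        · push Not at h
          have ha₁ := ha'.1
          interval_cases a
          · exact h.1
          · exact h.2
    rw [this, key 1 (m + 1) 1 (by omega), key 2 (m + 1) 0 (by omega), not_iff_not]
    constructor
    · rintro (⟨i, hi, hl, h⟩ | ⟨i, hi, hl, h⟩) <;> interval_cases i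
      · exact Or.inr (Or.inl ⟨by omega, h⟩)
      · exact Or.inl ⟨by omega, h⟩
      · exact Or.inr (Or.inr ⟨by omega, h⟩)
    · rintro (⟨hl, h⟩ | ⟨hl, h⟩ | ⟨hl, h⟩)
      · exact Or.inl ⟨1, by omega, by omega, h⟩
      · exact Or.inl ⟨0, by omega, by omega, h⟩
      · exact Or.inr ⟨0, by omega, by omega, h⟩

end Perms

/-- The condition for slack `1` on a word of length `N` whose three greatest letters stand at the
places `p₁`, `p₂`, `p₃`, counted from `0`; see `slow_one_iff`. -/
def SlowOneShape (N p₁ p₂ p₃ : ℕ) : Prop :=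
  N ≤ p₁ + 2 ∨ (p₁ < p₃ ∧ p₃ < p₂ ∧ p₂ + 1 = N)

/-- The condition that a permutation of `1, …, n` needs at least `n - 3` passes, where
`a₀, …, a₄` are the places of the letters `n, …, n - 4` and `p₁` that of `1`, the places of
`n, n - 1, n - 2, 2` after deletion of `1` are `q₀, q₁, q₂, l₂`, and the places of `n` and `3` after
deletion of `1` and `2` are `r₀` and `l₃`. All places are counted from `0`. -/
def LateShape (n a₀ a₁ a₂ a₃ a₄ p₁ q₀ q₁ q₂ l₂ r₀ l₃ : ℕ) : Prop :=
  (p₁ + 1 = n ∧ SlowTwoShape (n - 1) a₀ a₁ a₂ a₃ a₄) ∨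
  (p₁ + 2 = n ∧ ((a₀ + 1 = n ∧ SlowOneShape (n - 2) a₁ a₂ a₃) ∨
    (a₁ + 1 = n ∧ SlowOneShape (n - 2) a₀ a₂ a₃) ∨
    (a₂ + 1 = n ∧ SlowOneShape (n - 2) a₀ a₁ a₃) ∨
    (a₀ + 1 ≠ n ∧ a₁ + 1 ≠ n ∧ a₂ + 1 ≠ n ∧ SlowOneShape (n - 2) a₀ a₁ a₂))) ∨
  (p₁ + 3 = n ∧ (a₀ + 4 = n ∨ (p₁ < a₀ ∧ a₁ + 4 = n) ∨ (p₁ < a₀ ∧ p₁ < a₁ ∧ a₂ + 4 = n))) ∨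
  (l₂ + 2 = n ∧ SlowOneShape (n - 2) q₀ q₁ q₂) ∨
  (l₂ + 3 = n ∧ (q₀ + 4 = n ∨ (l₂ < q₀ ∧ q₁ + 4 = n))) ∨
  (l₃ + 3 = n ∧ r₀ + 4 = n)

/-- The condition that a permutation needs at least `n - 2` passes, with the notation of
`LateShape`. -/
def LaterShape (n a₀ a₁ a₂ p₁ q₀ l₂ : ℕ) : Prop :=
  (p₁ + 1 = n ∧ SlowOneShape (n - 1) a₀ a₁ a₂) ∨
  (p₁ + 2 = n ∧ (a₀ + 3 = n ∨ (p₁ < a₀ ∧ a₁ + 3 = n))) ∨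
  (l₂ + 2 = n ∧ q₀ + 3 = n)

/-- Slack `0` for the inversions at `a`, of which there are `l`, the greatest of them being `t`. -/
theorem slow_zero_inversionsAt_iff {w : List ℕ} (hw : w.Nodup) {a t l : ℕ}
    (hl : (w.filter (a ≤ ·)).idxOf a = l) (ht : (w.filter (a ≤ ·)).idxOf t < l)
    (hle : ∀ x ∈ w, a < x → (w.filter (a ≤ ·)).idxOf x < l → x ≤ t) :
    Slow 0 (inversionsAt a w) ↔ (w.filter (a ≤ ·)).idxOf t + 1 = l := by
  subst hl
  have ht' := (mem_inversionsAt_iff a t w).2 ht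
  rw [slow_zero_iff (nodup_inversionsAt hw a) ht', idxOf_inversionsAt ht', length_inversionsAt]
  intro x hx
  have := lt_and_mem_of_mem_inversionsAt hx
  exact hle x this.2 this.1 ((mem_inversionsAt_iff a x w).1 hx)

/-- Slack `1` for the inversions at `a`, of which there are `l`, the greatest of them being
`t₁ > t₂ > t₃`. -/
theorem slow_one_inversionsAt_iff {w : List ℕ} (hw : w.Nodup) {a t₁ t₂ t₃ l : ℕ}
    (hl : (w.filter (a ≤ ·)).idxOf a = l) (ht₁ : (w.filter (a ≤ ·)).idxOf t₁ < l)
    (ht₂ : (w.filter (a ≤ ·)).idxOf t₂ < l) (ht₃ : (w.filter (a ≤ ·)).idxOf t₃ < l)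
    (h₁₂ : t₂ < t₁) (h₂₃ : t₃ < t₂)
    (hle : ∀ x ∈ w, a < x → (w.filter (a ≤ ·)).idxOf x < l → x = t₁ ∨ x = t₂ ∨ x ≤ t₃) :
    Slow 1 (inversionsAt a w) ↔ SlowOneShape l ((w.filter (a ≤ ·)).idxOf t₁)
      ((w.filter (a ≤ ·)).idxOf t₂) ((w.filter (a ≤ ·)).idxOf t₃) := by
  subst hl
  have ht₁' := (mem_inversionsAt_iff a t₁ w).2 ht₁
  have ht₂' := (mem_inversionsAt_iff a t₂ w).2 ht₂
  have ht₃' := (mem_inversionsAt_iff a t₃ w).2 ht₃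
  rw [slow_one_iff (nodup_inversionsAt hw a) ht₁' ht₂' ht₃' h₁₂ h₂₃, idxOf_inversionsAt ht₁',
    idxOf_inversionsAt ht₂', idxOf_inversionsAt ht₃', length_inversionsAt]
  · rfl
  · intro x hx
    have := lt_and_mem_of_mem_inversionsAt hx
    exact hle x this.2 this.1 ((mem_inversionsAt_iff a x w).1 hx)

theorem mem_exactly_iff_shape {n : ℕ} {w : List ℕ} (hn : 6 ≤ n) (hw : w ∈ perms n) :
    w ∈ exactly n (n - 3) ↔
      LateShape n (w.idxOf n) (w.idxOf (n - 1)) (w.idxOf (n - 2)) (w.idxOf (n - 3))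
        (w.idxOf (n - 4)) (w.idxOf 1) ((w.filter (2 ≤ ·)).idxOf n)
        ((w.filter (2 ≤ ·)).idxOf (n - 1)) ((w.filter (2 ≤ ·)).idxOf (n - 2))
        ((w.filter (2 ≤ ·)).idxOf 2) ((w.filter (3 ≤ ·)).idxOf n) ((w.filter (3 ≤ ·)).idxOf 3) ∧
      ¬ LaterShape n (w.idxOf n) (w.idxOf (n - 1)) (w.idxOf (n - 2)) (w.idxOf 1)
        ((w.filter (2 ≤ ·)).idxOf n) ((w.filter (2 ≤ ·)).idxOf 2) := by
  have hnd := nodup_of_mem_perms hw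
  have hmem : ∀ a, 1 ≤ a → a ≤ n → a ∈ w := fun a h h' => (mem_iff_of_mem_perms hw).2 ⟨h, h'⟩
  have hle : ∀ x ∈ w, x ≤ n := fun x hx => ((mem_iff_of_mem_perms hw).1 hx).2
  have hlen := length_of_mem_perms hw
  have hlt : ∀ x, 1 ≤ x → x ≤ n → w.idxOf x < n := fun x h h' => by
    have := List.idxOf_lt_length_of_mem (hmem x h h')
    omega
  have hne : ∀ x, 1 ≤ x → x ≤ n → ∀ y, x ≠ y → w.idxOf x ≠ w.idxOf y := fun x h h' y hxy =>
    idxOf_ne_of_mem (hmem x h h') hxy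
  have hmemf : ∀ a x, a ≤ x → 1 ≤ x → x ≤ n → x ∈ w.filter (a ≤ ·) := fun a x ha h h' =>
    List.mem_filter.2 ⟨hmem x h h', by simpa using ha⟩
  have hltf : ∀ a x, a ≤ x → 1 ≤ x → x ≤ n → (w.filter (a ≤ ·)).idxOf x < n + 1 - a :=
    fun a x ha h h' => (List.idxOf_lt_length_of_mem (hmemf a x ha h h')).trans_le
      (length_filter_le_of_mem_perms hw a)
  have hnef : ∀ a x, a ≤ x → 1 ≤ x → x ≤ n → ∀ y, x ≠ y →
      (w.filter (a ≤ ·)).idxOf x ≠ (w.filter (a ≤ ·)).idxOf y := fun a x ha h h' y hxy =>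
    idxOf_ne_of_mem (hmemf a x ha h h') hxy
  have h1 := filter_one_le hw
  -- the places of the greatest letters and of `1`
  have b₀ := hlt n (by omega) le_rfl
  have b₁ := hlt (n - 1) (by omega) (by omega)
  have b₂ := hlt (n - 2) (by omega) (by omega)
  have b₃ := hlt (n - 3) (by omega) (by omega)
  have b₄ := hlt (n - 4) (by omega) (by omega)
  have c₁ := hlt 1 le_rfl (by omega)
  have q₀ := hltf 2 n (by omega) (by omega) le_rfl
  have q₁ := hltf 2 (n - 1) (by omega) (by omega) (by omega)
  have q₂ := hltf 2 (n - 2) (by omega) (by omega) (by omega)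
  have r₀ := hltf 3 n (by omega) (by omega) le_rfl
  -- a letter whose place is outside a prefix does not occur in it
  have hout : ∀ v : List ℕ, ∀ l t x : ℕ, l ≤ v.idxOf t → v.idxOf x < l → x ≠ t := by
    rintro v l t x h h' rfl
    omega
  have z1 := fun t l h => slow_zero_inversionsAt_iff (a := 1) (t := t) (l := l) hnd h
  have o1 := fun t₁ t₂ t₃ l h =>
    slow_one_inversionsAt_iff (a := 1) (t₁ := t₁) (t₂ := t₂) (t₃ := t₃) (l := l) hnd h
  rw [h1] at z1 o1
  have ho := hout w
  rw [mem_exactly_iff_slow hn hw, length_inversionsAt, length_inversionsAt, length_inversionsAt,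
    h1]
  unfold LateShape LaterShape
  refine and_congr (or_congr ?_ (or_congr ?_ (or_congr ?_ (or_congr ?_ (or_congr ?_ ?_)))))
    (not_congr (or_congr ?_ (or_congr ?_ ?_)))
  · refine and_congr_right fun hp => ?_
    have hin : ∀ x, 1 < x → x ≤ n → x ∈ inversionsAt 1 w := by
      intro x h h'
      have := hlt x (by omega) h'
      have := hne 1 le_rfl (by omega) x (by omega)
      rw [mem_inversionsAt_iff, h1]
      omega
    rw [slow_two_iff (nodup_inversionsAt hnd 1) (hin n (by omega) le_rfl)
      (hin (n - 1) (by omega) (by omega)) (hin (n - 2) (by omega) (by omega))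
      (hin (n - 3) (by omega) (by omega)) (hin (n - 4) (by omega) (by omega)) (by omega)
      (by omega) (by omega) (by omega),
      idxOf_inversionsAt (hin n (by omega) le_rfl),
      idxOf_inversionsAt (hin (n - 1) (by omega) (by omega)),
      idxOf_inversionsAt (hin (n - 2) (by omega) (by omega)),
      idxOf_inversionsAt (hin (n - 3) (by omega) (by omega)),
      idxOf_inversionsAt (hin (n - 4) (by omega) (by omega)), length_inversionsAt, h1,
      show w.idxOf 1 = n - 1 by omega]
    intro x hx
    have := hle x (lt_and_mem_of_mem_inversionsAt hx).2
    omega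
  · refine and_congr_right fun hp => ?_
    have d₀ := hne 1 le_rfl (by omega) n (by omega)
    have d₁ := hne 1 le_rfl (by omega) (n - 1) (by omega)
    have d₂ := hne 1 le_rfl (by omega) (n - 2) (by omega)
    have d₃ := hne 1 le_rfl (by omega) (n - 3) (by omega)
    have hp' : w.idxOf 1 = n - 2 := by omega
    by_cases k₀ : w.idxOf n + 1 = n
    · have l₁ : w.idxOf (n - 1) < n - 2 := by
        have := hne (n - 1) (by omega) (by omega) n (by omega)
        omega
      have l₂ : w.idxOf (n - 2) < n - 2 := by
        have := hne (n - 2) (by omega) (by omega) n (by omega)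
        omega
      have l₃ : w.idxOf (n - 3) < n - 2 := by
        have := hne (n - 3) (by omega) (by omega) n (by omega)
        omega
      rw [o1 (n - 1) (n - 2) (n - 3) (n - 2) hp' (by omega) (by omega) (by omega) (by omega)
        (by omega) fun x hx _ hlx => by
          have := hle x hx
          have := ho (n - 2) n x (by omega) hlx
          omega]
      have k₁ : w.idxOf (n - 1) + 1 ≠ n := by omega
      have k₂ : w.idxOf (n - 2) + 1 ≠ n := by omega
      simp [k₀, k₁, k₂]
    by_cases k₁ : w.idxOf (n - 1) + 1 = n
    · have l₀ : w.idxOf n < n - 2 := by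
        have := hne n (by omega) (by omega) (n - 1) (by omega)
        omega
      have l₂ : w.idxOf (n - 2) < n - 2 := by
        have := hne (n - 2) (by omega) (by omega) (n - 1) (by omega)
        omega
      have l₃ : w.idxOf (n - 3) < n - 2 := by
        have := hne (n - 3) (by omega) (by omega) (n - 1) (by omega)
        omega
      rw [o1 n (n - 2) (n - 3) (n - 2) hp' (by omega) (by omega) (by omega) (by omega)
        (by omega) fun x hx _ hlx => by
          have := hle x hx
          have := ho (n - 2) (n - 1) x (by omega) hlx
          omega]
      have k₂ : w.idxOf (n - 2) + 1 ≠ n := by omega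
      simp [k₀, k₁, k₂]
    by_cases k₂ : w.idxOf (n - 2) + 1 = n
    · have l₀ : w.idxOf n < n - 2 := by
        have := hne n (by omega) (by omega) (n - 2) (by omega)
        omega
      have l₁ : w.idxOf (n - 1) < n - 2 := by
        have := hne (n - 1) (by omega) (by omega) (n - 2) (by omega)
        omega
      have l₃ : w.idxOf (n - 3) < n - 2 := by
        have := hne (n - 3) (by omega) (by omega) (n - 2) (by omega)
        omega
      rw [o1 n (n - 1) (n - 3) (n - 2) hp' (by omega) (by omega) (by omega) (by omega)
        (by omega) fun x hx _ hlx => by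
          have := hle x hx
          have := ho (n - 2) (n - 2) x (by omega) hlx
          omega]
      simp [k₀, k₁, k₂]
    · have l₀ : w.idxOf n < n - 2 := by omega
      have l₁ : w.idxOf (n - 1) < n - 2 := by omega
      have l₂ : w.idxOf (n - 2) < n - 2 := by omega
      rw [o1 n (n - 1) (n - 2) (n - 2) hp' (by omega) (by omega) (by omega) (by omega)
        (by omega) fun x hx _ hlx => by
          have := hle x hx
          omega]
      simp [k₀, k₁, k₂]
  · refine and_congr_right fun hp => ?_
    have d₀ := hne 1 le_rfl (by omega) n (by omega)
    have d₁ := hne 1 le_rfl (by omega) (n - 1) (by omega)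
    have d₂ := hne 1 le_rfl (by omega) (n - 2) (by omega)
    have e₀₁ := hne n (by omega) (by omega) (n - 1) (by omega)
    have e₀₂ := hne n (by omega) (by omega) (n - 2) (by omega)
    have e₁₂ := hne (n - 1) (by omega) (by omega) (n - 2) (by omega)
    have hp' : w.idxOf 1 = n - 3 := by omega
    by_cases k₀ : w.idxOf n < w.idxOf 1
    · rw [z1 n (n - 3) hp' (by omega) fun x hx _ _ => hle x hx]
      omega
    by_cases k₁ : w.idxOf (n - 1) < w.idxOf 1
    · rw [z1 (n - 1) (n - 3) hp' (by omega) fun x hx _ hlx => by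
        have := hle x hx
        have := ho (n - 3) n x (by omega) hlx
        omega]
      omega
    · rw [z1 (n - 2) (n - 3) hp' (by omega) fun x hx _ hlx => by
        have := hle x hx
        have := ho (n - 3) n x (by omega) hlx
        have := ho (n - 3) (n - 1) x (by omega) hlx
        omega]
      omega
  · refine and_congr_right fun hp => ?_
    have f₀ := hnef 2 2 le_rfl (by omega) (by omega) n (by omega)
    have f₁ := hnef 2 2 le_rfl (by omega) (by omega) (n - 1) (by omega)
    have f₂ := hnef 2 2 le_rfl (by omega) (by omega) (n - 2) (by omega)
    exact slow_one_inversionsAt_iff hnd (by omega) (by omega) (by omega) (by omega) (by omega)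
      (by omega) fun x hx _ _ => by
        have := hle x hx
        omega
  · refine and_congr_right fun hp => ?_
    have f₀ := hnef 2 2 le_rfl (by omega) (by omega) n (by omega)
    have f₁ := hnef 2 2 le_rfl (by omega) (by omega) (n - 1) (by omega)
    have f₀₁ := hnef 2 n (by omega) (by omega) le_rfl (n - 1) (by omega)
    by_cases k₀ : (w.filter (2 ≤ ·)).idxOf n < (w.filter (2 ≤ ·)).idxOf 2
    · rw [slow_zero_inversionsAt_iff hnd rfl k₀ fun x hx _ _ => hle x hx]
      omega
    · rw [slow_zero_inversionsAt_iff (t := n - 1) hnd rfl (by omega) fun x hx _ hlx => by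
        have := hle x hx
        have := hout _ _ n x (not_lt.1 k₀) hlx
        omega]
      omega
  · refine and_congr_right fun hp => ?_
    have g₀ := hnef 3 3 le_rfl (by omega) (by omega) n (by omega)
    rw [slow_zero_inversionsAt_iff (t := n) hnd rfl (by omega) fun x hx _ _ => hle x hx]
    omega
  · refine and_congr_right fun hp => ?_
    have d₀ := hne 1 le_rfl (by omega) n (by omega)
    have d₁ := hne 1 le_rfl (by omega) (n - 1) (by omega)
    have d₂ := hne 1 le_rfl (by omega) (n - 2) (by omega)
    exact o1 n (n - 1) (n - 2) (n - 1) (by omega) (by omega) (by omega) (by omega) (by omega)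
      (by omega) fun x hx _ _ => by
        have := hle x hx
        omega
  · refine and_congr_right fun hp => ?_
    have d₀ := hne 1 le_rfl (by omega) n (by omega)
    have d₁ := hne 1 le_rfl (by omega) (n - 1) (by omega)
    have e₀₁ := hne n (by omega) (by omega) (n - 1) (by omega)
    have hp' : w.idxOf 1 = n - 2 := by omega
    by_cases k₀ : w.idxOf n < w.idxOf 1
    · rw [z1 n (n - 2) hp' (by omega) fun x hx _ _ => hle x hx]
      omega
    · rw [z1 (n - 1) (n - 2) hp' (by omega) fun x hx _ hlx => by
        have := hle x hx
        have := ho (n - 2) n x (by omega) hlx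
        omega]
      omega
  · refine and_congr_right fun hp => ?_
    have f₀ := hnef 2 2 le_rfl (by omega) (by omega) n (by omega)
    rw [slow_zero_inversionsAt_iff (t := n) hnd rfl (by omega) fun x hx _ _ => hle x hx]
    omega

/-! ### The five types in terms of places -/

/-- `type1` in terms of the places `a₀, …, a₃` of `n, …, n - 3` and `p₁, p₂` of `1, 2`, counted
from `0`. -/
def TypeOneShape (n a₀ a₁ a₂ a₃ p₁ p₂ : ℕ) : Prop :=
  a₀ + 1 = n ∧
    ((a₁ + 3 = n ∧ p₂ + 2 = n) ∨
      (a₁ + 4 = n ∧ p₁ + 2 = n) ∨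
      (a₁ + 4 = n ∧ p₁ + 3 = n) ∨
      (a₁ < a₃ ∧ a₃ < a₂ ∧ a₂ + 3 = n ∧ p₁ + 2 = n) ∨
      (a₂ + 4 = n ∧ p₁ + 3 = n ∧ a₁ + 2 = n))

/-- `type2` in terms of the places of `n, n - 1, n - 2, 1, 2, 3`. -/
def TypeTwoShape (n a₀ a₁ a₂ p₁ p₂ p₃ : ℕ) : Prop :=
  a₀ + 2 = n ∧
    (p₃ + 1 = n ∨
      (a₁ + 4 = n ∧ p₁ + 3 = n ∧ p₂ + 1 ≠ n ∧ p₃ + 1 ≠ n) ∨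
      (a₂ + 4 = n ∧ p₁ + 3 = n ∧ a₁ + 1 = n))

/-- `type3` in terms of the places of `n, 1, 2`. -/
def TypeThreeShape (n a₀ p₁ p₂ : ℕ) : Prop :=
  a₀ + 3 = n ∧ ((p₂ + 2 = n ∧ p₁ + 1 ≠ n) ∨ (p₂ + 1 = n ∧ p₁ + 2 ≠ n))

/-- `type4` in terms of the places of `n, n - 1, n - 2, 1, 2`. -/
def TypeFourShape (n a₀ a₁ a₂ p₁ p₂ : ℕ) : Prop :=
  a₀ + 4 = n ∧
    ((p₁ + 1 = n ∧ ¬ (a₂ + 3 = n ∧ a₁ + 2 = n)) ∨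
      p₁ + 2 = n ∨
      p₁ + 3 = n ∨
      (a₂ + 3 = n ∧ a₁ + 2 = n ∧ p₂ + 1 = n))

/-- `type5` in terms of the places of `n, …, n - 4, 1, 2`. -/
def TypeFiveShape (n a₀ a₁ a₂ a₃ a₄ p₁ p₂ : ℕ) : Prop :=
  a₀ + 4 < n ∧
    ((a₀ < a₂ ∧ a₂ < a₁ ∧ a₁ + 2 = n ∧ p₂ + 1 = n ∧ ¬ (a₂ = a₀ + 1 ∧ a₁ = a₂ + 1)) ∨
      (a₀ < a₃ ∧ a₃ < a₁ ∧ a₁ + 3 = n ∧ a₂ + 2 = n ∧ p₁ + 1 = n) ∨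
      (a₀ < a₁ ∧ a₁ < a₃ ∧ a₃ < a₂ ∧ a₂ + 2 = n ∧ p₁ + 1 = n) ∨
      (a₁ < a₀ ∧ a₀ < a₃ ∧ a₃ < a₄ ∧ a₄ < a₂ ∧ a₂ + 2 = n ∧ p₁ + 1 = n) ∨
      (a₁ < a₀ ∧ a₀ < a₄ ∧ a₄ < a₃ ∧ a₃ < a₂ ∧ a₂ + 2 = n ∧ p₁ + 1 = n) ∨
      (a₀ < a₂ ∧ a₂ < a₁ ∧ a₁ + 3 = n ∧ p₁ + 2 = n) ∨
      (a₀ < a₂ ∧ a₂ < a₁ ∧ a₁ + 3 = n ∧ p₁ + 1 = n) ∨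
      (a₀ < a₃ ∧ a₃ < a₁ ∧ a₁ + 3 = n ∧ p₁ + 2 = n ∧ a₂ + 1 = n) ∨
      (a₀ < a₃ ∧ a₃ < a₂ ∧ a₂ + 3 = n ∧ p₁ + 2 = n ∧ a₁ + 1 = n) ∨
      (a₂ < a₀ ∧ a₀ < a₃ ∧ a₃ < a₄ ∧ a₄ < a₁ ∧ a₁ + 2 = n ∧ p₁ + 1 = n) ∨
      (a₂ < a₀ ∧ a₀ < a₄ ∧ a₄ < a₃ ∧ a₃ < a₁ ∧ a₁ + 2 = n ∧ p₁ + 1 = n))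

/-- The union of the five types, in terms of places. -/
def TypeShape (n a₀ a₁ a₂ a₃ a₄ p₁ p₂ p₃ : ℕ) : Prop :=
  TypeOneShape n a₀ a₁ a₂ a₃ p₁ p₂ ∨ TypeTwoShape n a₀ a₁ a₂ p₁ p₂ p₃ ∨
    TypeThreeShape n a₀ p₁ p₂ ∨ TypeFourShape n a₀ a₁ a₂ p₁ p₂ ∨
    TypeFiveShape n a₀ a₁ a₂ a₃ a₄ p₁ p₂

set_option maxHeartbeats 4000000 in
/-- The shapes derived from slackness and the shapes of the five types agree. The hypotheses say
that the places are distinct and how they change when `1` and `2` are deleted. -/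
theorem lateShape_and_not_laterShape_iff {n a₀ a₁ a₂ a₃ a₄ p₁ p₂ p₃ q₀ q₁ q₂ l₂ r₀ l₃ : ℕ}
    (hn : 6 ≤ n) (b₀ : a₀ < n) (b₁ : a₁ < n) (b₂ : a₂ < n) (b₃ : a₃ < n) (b₄ : a₄ < n)
    (c₁ : p₁ < n) (c₂ : p₂ < n) (c₃ : p₃ < n) (d₀₁ : a₀ ≠ a₁) (d₀₂ : a₀ ≠ a₂) (d₀₃ : a₀ ≠ a₃)
    (d₁₂ : a₁ ≠ a₂) (d₁₃ : a₁ ≠ a₃) (d₁₄ : a₁ ≠ a₄) (d₂₃ : a₂ ≠ a₃)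
    (d₂₄ : a₂ ≠ a₄) (d₃₄ : a₃ ≠ a₄) (e₁₂ : p₁ ≠ p₂) (e₁₃ : p₁ ≠ p₃) (e₂₃ : p₂ ≠ p₃)
    (f₀₁ : a₀ ≠ p₁) (f₀₂ : a₀ ≠ p₂) (f₀₃ : a₀ ≠ p₃) (f₁₁ : a₁ ≠ p₁) (f₁₂ : a₁ ≠ p₂)
    (f₁₃ : a₁ ≠ p₃) (f₂₁ : a₂ ≠ p₁) (f₂₂ : a₂ ≠ p₂) (f₂₃ : a₂ ≠ p₃) (f₃₁ : a₃ ≠ p₁)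
    (f₄₁ : a₄ ≠ p₁) (hq₀ : q₀ = if p₁ < a₀ then a₀ - 1 else a₀)
    (hq₁ : q₁ = if p₁ < a₁ then a₁ - 1 else a₁) (hq₂ : q₂ = if p₁ < a₂ then a₂ - 1 else a₂)
    (hl₂ : l₂ = if p₁ < p₂ then p₂ - 1 else p₂) (hr₀ : r₀ = if p₂ < a₀ then q₀ - 1 else q₀)
    (hl₃ : l₃ = p₃ - (if p₁ < p₃ then 1 else 0) - if p₂ < p₃ then 1 else 0) :
    LateShape n a₀ a₁ a₂ a₃ a₄ p₁ q₀ q₁ q₂ l₂ r₀ l₃ ∧ ¬ LaterShape n a₀ a₁ a₂ p₁ q₀ l₂ ↔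
      TypeShape n a₀ a₁ a₂ a₃ a₄ p₁ p₂ p₃ := by
  unfold LateShape LaterShape TypeShape TypeOneShape TypeTwoShape TypeThreeShape TypeFourShape
    TypeFiveShape SlowOneShape SlowTwoShape
  constructor
  · rintro ⟨h, h'⟩
    have h0 : a₀ + 1 = n ∨ a₀ + 2 = n ∨ a₀ + 3 = n ∨ a₀ + 4 = n ∨ a₀ + 4 < n := by omega
    rcases h with ⟨hp, h | h | h | h | h | h | h⟩ |
      ⟨hp, ⟨ha, h | h⟩ | ⟨ha, h | h⟩ | ⟨ha, h | h⟩ | ⟨ha₀, ha₁, ha₂, h | h⟩⟩ |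
      ⟨hp, h | ⟨hlt, h⟩ | ⟨hlt, hlt', h⟩⟩ | ⟨hl, h | h⟩ | ⟨hl, h | ⟨hlt, h⟩⟩ | ⟨hl, h⟩
    -- all cases but two are settled by splitting on the place of `n`
    pick_goal 20
    · clear h0
      have h0 : a₀ + 4 ≤ n := by grind
      have h1 : a₀ < a₂ ∧ a₂ < a₁ := by grind
      by_cases hp : p₁ < a₁
      · have h2 : p₂ + 1 = n := by grind
        have h3 : a₁ + 2 = n := by grind
        clear hq₀ hq₁ hq₂ hl₂ hr₀ hl₃ h h' hl
        grind
      · have h3 : a₁ + 3 = n := by grind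
        have h4 : p₁ + 1 = n ∨ p₁ + 2 = n := by omega
        clear hq₀ hq₁ hq₂ hl₂ hr₀ hl₃ h h' hl
        grind
    pick_goal 21
    · clear h0
      by_cases hp : p₁ < p₂
      · have h0 : a₀ + 1 = n := by grind
        have h2 : p₂ + 2 = n := by grind
        by_cases hp' : p₁ < a₁
        · have h3 : a₁ + 3 = n := by grind
          exact Or.inl ⟨h0, Or.inl ⟨h3, h2⟩⟩
        · have h3 : a₁ + 4 = n := by grind
          have h4 : p₁ + 3 = n := by omega
          exact Or.inl ⟨h0, Or.inr (Or.inr (Or.inl ⟨h3, h4⟩))⟩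
      · have h2 : p₂ + 3 = n := by grind
        have h0 : a₀ + 1 = n := by grind
        have h1 : p₁ + 2 = n := by grind
        have h3 : a₁ + 4 = n := by grind
        exact Or.inl ⟨h0, Or.inr (Or.inl ⟨h3, h1⟩)⟩
    all_goals rcases h0 with h0 | h0 | h0 | h0 | h0 <;> grind
  · rintro (⟨h0, h | h | h | h | h⟩ | ⟨h0, h | h | h⟩ | ⟨h0, h | h⟩ | ⟨h0, h | h | h | h⟩ |
      ⟨h0, h | h | h | h | h | h | h | h | h | h | h⟩) <;> constructor <;> grind (splits := 30)

/-! ### Patterns in terms of places -/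

theorem drop_mem_glob_nil_iff (w : List ℕ) (i : ℕ) : w.drop i ∈ glob [] ↔ w.length ≤ i := by
  change w.drop i = [] ↔ _
  rw [List.drop_eq_nil_iff]

theorem drop_mem_glob_any_iff (w : List ℕ) (i : ℕ) (p : List Glob) :
    w.drop i ∈ glob (.any :: p) ↔ i < w.length ∧ w.drop (i + 1) ∈ glob p := by
  constructor
  · rintro ⟨u, ⟨a, rfl⟩, v, hv, h⟩
    have hi : i < w.length := by
      by_contra! hle
      rw [List.drop_eq_nil_of_le hle] at h
      simp at h
    rw [List.drop_eq_getElem_cons hi] at h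
    simp only [List.singleton_append, List.cons.injEq] at h
    exact ⟨hi, h.2 ▸ hv⟩
  · rintro ⟨hi, h⟩
    exact ⟨[w[i]], ⟨_, rfl⟩, _, h, List.drop_eq_getElem_cons hi⟩

/-- In a word with distinct letters, a letter is at the place `i` when that is its index. -/
theorem idxOf_eq_iff_getElem {w : List ℕ} (hw : w.Nodup) {i a : ℕ} (hi : i < w.length) :
    w.idxOf a = i ↔ w[i] = a := by
  constructor
  · rintro rfl
    exact List.getElem_idxOf hi
  · rintro rfl
    exact hw.idxOf_getElem i hi

theorem drop_mem_glob_lit_iff {w : List ℕ} (hw : w.Nodup) (i a : ℕ) (p : List Glob) :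
    w.drop i ∈ glob (.lit a :: p) ↔
      w.idxOf a = i ∧ i < w.length ∧ w.drop (i + 1) ∈ glob p := by
  constructor
  · rintro ⟨u, hu, v, hv, h⟩
    obtain rfl : u = [a] := hu
    have hi : i < w.length := by
      by_contra! hle
      rw [List.drop_eq_nil_of_le hle] at h
      simp at h
    rw [List.drop_eq_getElem_cons hi] at h
    simp only [List.singleton_append, List.cons.injEq] at h
    exact ⟨(idxOf_eq_iff_getElem hw hi).2 h.1, hi, h.2 ▸ hv⟩
  · rintro ⟨ha, hi, h⟩
    refine ⟨[a], rfl, _, h, ?_⟩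
    rw [List.drop_eq_getElem_cons hi, (idxOf_eq_iff_getElem hw hi).1 ha]
    rfl

/-- The asterisk stands for the letters up to the only occurrence of `a`, so that a match of the
rest of the pattern has to go on from there. -/
theorem drop_mem_glob_star_lit_iff {w : List ℕ} (hw : w.Nodup) (i a : ℕ) (p : List Glob) :
    w.drop i ∈ glob (.star :: .lit a :: p) ↔
      i ≤ w.idxOf a ∧ w.idxOf a < w.length ∧ w.drop (w.idxOf a + 1) ∈ glob p := by
  constructor
  · rintro ⟨u, -, v, hv, h⟩
    have hv' : v = w.drop (i + u.length) := by
      rw [← List.drop_drop, h, List.drop_left]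
    rw [hv', drop_mem_glob_lit_iff hw] at hv
    obtain ⟨h1, h2, h3⟩ := hv
    rw [h1]
    exact ⟨by omega, h2, h3⟩
  · rintro ⟨h1, h2, h3⟩
    refine ⟨(w.drop i).take (w.idxOf a - i), trivial, w.drop (w.idxOf a), ?_, ?_⟩
    · exact (drop_mem_glob_lit_iff hw _ _ _).2 ⟨rfl, h2, h3⟩
    · conv_lhs => rw [← List.take_append_drop (w.idxOf a - i) (w.drop i)]
      rw [List.drop_drop, Nat.add_sub_cancel' h1]

theorem mem_glob_star_lit_iff {w : List ℕ} (hw : w.Nodup) (a : ℕ) (p : List Glob) :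
    w ∈ glob (.star :: .lit a :: p) ↔
      w.idxOf a < w.length ∧ w.drop (w.idxOf a + 1) ∈ glob p := by
  simpa using drop_mem_glob_star_lit_iff hw 0 a p

theorem entryIs_iff {w : List ℕ} (hw : w.Nodup) (i a : ℕ) :
    entryIs w i a ↔ w.idxOf a + 1 = i ∧ i ≤ w.length := by
  unfold entryIs
  rw [List.getElem?_eq_some_iff]
  constructor
  · rintro ⟨h1, h2, h3⟩
    have := (idxOf_eq_iff_getElem hw h2).2 h3
    omega
  · rintro ⟨h1, h2⟩
    have h3 : i - 1 < w.length := by omega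
    exact ⟨by omega, h3, (idxOf_eq_iff_getElem hw h3).1 (by omega)⟩

/-- `f` sends the letters `1, …, n` to distinct places below `n`. -/
structure IsPlacement (n : ℕ) (f : ℕ → ℕ) : Prop where
  lt (x : ℕ) (hx : 1 ≤ x := by omega) (hx' : x ≤ n := by omega) : f x < n
  ne (x y : ℕ) (hx : 1 ≤ x := by omega) (hx' : x ≤ n := by omega) (hy : 1 ≤ y := by omega)
    (hy' : y ≤ n := by omega) (hxy : x ≠ y := by omega) : f x ≠ f y

theorem isPlacement_idxOf {n : ℕ} {w : List ℕ} (hw : w ∈ perms n) : IsPlacement n w.idxOf where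
  lt x hx hx' := by
    have := List.idxOf_lt_length_of_mem ((mem_iff_of_mem_perms hw).2 ⟨hx, hx'⟩)
    rwa [length_of_mem_perms hw] at this
  ne _ _ hx hx' _ _ hxy := idxOf_ne_of_mem ((mem_iff_of_mem_perms hw).2 ⟨hx, hx'⟩) hxy

section Types

variable {n : ℕ} {w : List ℕ}

theorem mem_type1_iff (hw : w ∈ perms n) : w ∈ type1 n ↔
    TypeOneShape n (w.idxOf n) (w.idxOf (n - 1)) (w.idxOf (n - 2)) (w.idxOf (n - 3))
      (w.idxOf 1) (w.idxOf 2) := by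
  have hnd := nodup_of_mem_perms hw
  have hlen := length_of_mem_perms hw
  unfold type1 TypeOneShape
  simp only [Set.mem_inter_iff, Set.mem_union, Set.mem_ofPred_eq, entryIs_iff hnd,
    mem_glob_star_lit_iff hnd, drop_mem_glob_star_lit_iff hnd, drop_mem_glob_lit_iff hnd,
    drop_mem_glob_any_iff, drop_mem_glob_nil_iff, hlen]
  generalize w.idxOf n = a₀, w.idxOf (n - 1) = a₁, w.idxOf (n - 2) = a₂, w.idxOf (n - 3) = a₃,
    w.idxOf 1 = p₁, w.idxOf 2 = p₂
  clear hw hnd hlen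
  rw [show (a₀ + 1 = n ∧ n ≤ n) ↔ a₀ + 1 = n by omega]
  refine and_congr_right fun h0 => ?_
  simp only [or_assoc]
  refine or_congr ?_ (or_congr ?_ (or_congr ?_ (or_congr ?_ ?_)))
  all_goals omega

theorem exists_idxOf_eq (hw : w ∈ perms n) {i : ℕ} (hi : i < n) :
    ∃ k, 1 ≤ k ∧ k ≤ n ∧ w.idxOf k = i := by
  have hi' : i < w.length := by rwa [length_of_mem_perms hw]
  have := (mem_iff_of_mem_perms hw).1 (List.getElem_mem hi')
  exact ⟨w[i], this.1, this.2, (nodup_of_mem_perms hw).idxOf_getElem i hi'⟩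

theorem mem_type2_iff (hn : 6 ≤ n) (hw : w ∈ perms n) : w ∈ type2 n ↔
    TypeTwoShape n (w.idxOf n) (w.idxOf (n - 1)) (w.idxOf (n - 2)) (w.idxOf 1) (w.idxOf 2)
      (w.idxOf 3) := by
  have hnd := nodup_of_mem_perms hw
  have hlen := length_of_mem_perms hw
  have hk : (∃ k, 3 < k ∧ w.idxOf k = n - 1) ↔
      w.idxOf 1 + 1 ≠ n ∧ w.idxOf 2 + 1 ≠ n ∧ w.idxOf 3 + 1 ≠ n := by
    constructor
    · rintro ⟨k, hk, h⟩
      have hne : ∀ x, 1 ≤ x → x ≤ n → x ≠ k → w.idxOf x ≠ w.idxOf k := fun x h h' hxk =>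
        idxOf_ne_of_mem ((mem_iff_of_mem_perms hw).2 ⟨h, h'⟩) hxk
      have h1 := hne 1 (by omega) (by omega) (by omega)
      have h2 := hne 2 (by omega) (by omega) (by omega)
      have h3 := hne 3 (by omega) (by omega) (by omega)
      omega
    · intro h
      obtain ⟨k, hk, -, hi⟩ := exists_idxOf_eq hw (show n - 1 < n by omega)
      refine ⟨k, ?_, hi⟩
      by_contra! hle
      interval_cases k <;> omega
  unfold type2 TypeTwoShape
  simp only [Set.mem_inter_iff, Set.mem_union, Set.mem_ofPred_eq, entryIs_iff hnd,
    mem_glob_star_lit_iff hnd, drop_mem_glob_lit_iff hnd,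
    drop_mem_glob_nil_iff, hlen]
  have h1 : w.idxOf n + 1 = n - 1 → ((∃ k, 3 < k ∧ w.idxOf (n - 1) < n ∧
      w.idxOf 1 = w.idxOf (n - 1) + 1 ∧ w.idxOf (n - 1) + 1 < n ∧
      w.idxOf n = w.idxOf (n - 1) + 1 + 1 ∧ w.idxOf (n - 1) + 1 + 1 < n ∧
      w.idxOf k = w.idxOf (n - 1) + 1 + 1 + 1 ∧ w.idxOf (n - 1) + 1 + 1 + 1 < n ∧
      n ≤ w.idxOf (n - 1) + 1 + 1 + 1 + 1) ↔ w.idxOf (n - 1) + 4 = n ∧ w.idxOf 1 + 3 = n ∧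
        ∃ k, 3 < k ∧ w.idxOf k = n - 1) := by
    intro h0
    constructor
    · rintro ⟨k, hk⟩
      exact ⟨by omega, by omega, k, by omega⟩
    · rintro ⟨h1, h2, k, hk⟩
      exact ⟨k, by omega⟩
  generalize w.idxOf n = a₀, w.idxOf (n - 1) = a₁, w.idxOf (n - 2) = a₂,
    w.idxOf 1 = p₁, w.idxOf 2 = p₂, w.idxOf 3 = p₃ at *
  clear hw hnd hlen
  constructor
  · rintro ⟨h0, (h | h) | h⟩
    · omega
    · have := (h1 (by omega)).1 h
      rw [hk] at this
      omega
    · omega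
  · rintro ⟨h0, h | h | h⟩
    · omega
    · exact ⟨by omega, Or.inl (Or.inr ((h1 (by omega)).2 ⟨h.1, h.2.1, hk.2 (by omega)⟩))⟩
    · omega

theorem mem_type3_iff (hn : 6 ≤ n) (hw : w ∈ perms n) : w ∈ type3 n ↔
    TypeThreeShape n (w.idxOf n) (w.idxOf 1) (w.idxOf 2) := by
  have hnd := nodup_of_mem_perms hw
  have hlen := length_of_mem_perms hw
  have hk : ∀ i < n, (∃ k, k ≠ 1 ∧ w.idxOf k = i) ↔ w.idxOf 1 ≠ i := by
    intro i hin
    constructor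
    · rintro ⟨k, hk, rfl⟩
      exact idxOf_ne_of_mem ((mem_iff_of_mem_perms hw).2 ⟨le_rfl, by omega⟩) hk.symm
    · intro h
      obtain ⟨k, -, -, hi⟩ := exists_idxOf_eq hw hin
      exact ⟨k, fun h' => h (h' ▸ hi), hi⟩
  have hk₁ := hk (n - 1) (by omega)
  have hk₂ := hk (n - 2) (by omega)
  unfold type3 TypeThreeShape
  simp only [Set.mem_inter_iff, Set.mem_union, Set.mem_ofPred_eq, entryIs_iff hnd,
    mem_glob_star_lit_iff hnd, drop_mem_glob_lit_iff hnd,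
    drop_mem_glob_nil_iff, hlen]
  constructor
  · rintro ⟨h0, ⟨k, h1, h⟩ | ⟨k, h1, h⟩⟩
    · have := hk₁.1 ⟨k, h1, by omega⟩
      omega
    · have := hk₂.1 ⟨k, h1, by omega⟩
      omega
  · rintro ⟨h0, h | h⟩
    · obtain ⟨k, h1, h2⟩ := hk₁.2 (by omega)
      exact ⟨by omega, Or.inl ⟨k, h1, by omega⟩⟩
    · obtain ⟨k, h1, h2⟩ := hk₂.2 (by omega)
      exact ⟨by omega, Or.inr ⟨k, h1, by omega⟩⟩

theorem mem_type4_iff (hn : 6 ≤ n) (hw : w ∈ perms n) : w ∈ type4 n ↔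
    TypeFourShape n (w.idxOf n) (w.idxOf (n - 1)) (w.idxOf (n - 2)) (w.idxOf 1)
      (w.idxOf 2) := by
  have hnd := nodup_of_mem_perms hw
  have hlen := length_of_mem_perms hw
  unfold type4 TypeFourShape
  simp only [Set.mem_inter_iff, Set.mem_union, Set.mem_sdiff, Set.mem_ofPred_eq, entryIs_iff hnd,
    mem_glob_star_lit_iff hnd, drop_mem_glob_lit_iff hnd,
    drop_mem_glob_any_iff, drop_mem_glob_nil_iff, hlen]
  generalize w.idxOf n = a₀, w.idxOf (n - 1) = a₁, w.idxOf (n - 2) = a₂,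
    w.idxOf 1 = p₁, w.idxOf 2 = p₂
  clear hw hnd hlen
  rw [show (a₀ + 1 = n - 3 ∧ n - 3 ≤ n) ↔ a₀ + 4 = n by omega]
  refine and_congr_right fun h0 => ?_
  simp only [or_assoc]
  refine or_congr ?_ (or_congr ?_ (or_congr ?_ ?_))
  all_goals omega

/-- The form `∗ n A (n - 2) B (n - 1) 2` with `A` and `B` not both empty, in terms of a pattern and
places. -/
theorem exists_eq_append_iff (hn : 6 ≤ n) (hw : w ∈ perms n) :
    (∃ C A B : List ℕ, w = C ++ [n] ++ A ++ [n - 2] ++ B ++ [n - 1, 2] ∧ (A ≠ [] ∨ B ≠ [])) ↔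
      w ∈ glob [.star, .lit n, .star, .lit (n - 2), .star, .lit (n - 1), .lit 2] ∧
        ¬ (w.idxOf (n - 2) = w.idxOf n + 1 ∧ w.idxOf (n - 1) = w.idxOf (n - 2) + 1) := by
  have hnd := nodup_of_mem_perms hw
  have key : ∀ C A B : List ℕ, w = C ++ [n] ++ A ++ [n - 2] ++ B ++ [n - 1, 2] →
      w.idxOf n = C.length ∧ w.idxOf (n - 2) = C.length + 1 + A.length ∧
        w.idxOf (n - 1) = C.length + 1 + A.length + 1 + B.length := by
    intro C A B h
    have hm : ∀ x, 1 ≤ x → x ≤ n → x ∈ w := fun x h h' => (mem_iff_of_mem_perms hw).2 ⟨h, h'⟩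
    have h1 := (mem_iff_idxOf (L := C) (m := n) (R := A ++ [n - 2] ++ B ++ [n - 1, 2])
      (by simp [h]) hnd (hm n (by omega) le_rfl)).2.1.1 rfl
    have h2 := (mem_iff_idxOf (L := C ++ [n] ++ A) (m := n - 2) (R := B ++ [n - 1, 2])
      (by simp [h]) hnd (hm (n - 2) (by omega) (by omega))).2.1.1 rfl
    have h3 := (mem_iff_idxOf (L := C ++ [n] ++ A ++ [n - 2] ++ B) (m := n - 1) (R := [2])
      (by simp [h]) hnd (hm (n - 1) (by omega) (by omega))).2.1.1 rfl
    simp only [List.length_append, List.length_singleton] at h1 h2 h3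
    exact ⟨h1, h2, h3⟩
  have hpos : ∀ l : List ℕ, l ≠ [] ↔ l.length ≠ 0 := fun l => by simp
  constructor
  · rintro ⟨C, A, B, h, hAB⟩
    refine ⟨⟨C, trivial, _, ⟨[n], rfl, _, ⟨A, trivial, _, ⟨[n - 2], rfl, _, ⟨B, trivial, _,
      ⟨[n - 1], rfl, _, ⟨[2], rfl, _, rfl, rfl⟩, rfl⟩, rfl⟩, rfl⟩, rfl⟩, rfl⟩, by simp [h]⟩, ?_⟩
    have := key C A B h
    rw [hpos, hpos] at hAB
    omega
  · rintro ⟨⟨C, -, _, ⟨_, rfl, _, ⟨A, -, _, ⟨_, rfl, _, ⟨B, -, _, ⟨_, rfl, _, ⟨_, rfl, _, rfl,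
      rfl⟩, rfl⟩, rfl⟩, rfl⟩, rfl⟩, rfl⟩, h⟩, hAB⟩
    have h' : w = C ++ [n] ++ A ++ [n - 2] ++ B ++ [n - 1, 2] := by simp [h]
    refine ⟨C, A, B, h', ?_⟩
    have := key C A B h'
    rw [hpos, hpos]
    omega

theorem mem_type5_iff (hn : 6 ≤ n) (hw : w ∈ perms n) : w ∈ type5 n ↔
    TypeFiveShape n (w.idxOf n) (w.idxOf (n - 1)) (w.idxOf (n - 2)) (w.idxOf (n - 3))
      (w.idxOf (n - 4)) (w.idxOf 1) (w.idxOf 2) := by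
  have hnd := nodup_of_mem_perms hw
  have hlen := length_of_mem_perms hw
  have hi : (∃ i, 3 < i ∧ w.idxOf n + 1 = n - i ∧ n - i ≤ n) ↔ w.idxOf n + 4 < n := by
    constructor
    · rintro ⟨i, h⟩
      omega
    · intro h
      exact ⟨n - (w.idxOf n + 1), by omega⟩
  unfold type5 TypeFiveShape
  simp only [Set.mem_inter_iff, Set.mem_union, Set.mem_ofPred_eq, entryIs_iff hnd,
    exists_eq_append_iff hn hw, or_assoc,
    mem_glob_star_lit_iff hnd, drop_mem_glob_star_lit_iff hnd, drop_mem_glob_lit_iff hnd,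
    drop_mem_glob_any_iff, drop_mem_glob_nil_iff, hlen, hi]
  generalize w.idxOf n = a₀, w.idxOf (n - 1) = a₁, w.idxOf (n - 2) = a₂, w.idxOf (n - 3) = a₃,
    w.idxOf (n - 4) = a₄, w.idxOf 1 = p₁, w.idxOf 2 = p₂
  clear hi hw hnd hlen
  refine and_congr_right fun h0 => ?_
  refine or_congr ?_ (or_congr ?_ (or_congr ?_ (or_congr ?_ (or_congr ?_ (or_congr ?_
    (or_congr ?_ (or_congr ?_ (or_congr ?_ (or_congr ?_ ?_)))))))))
  all_goals omega

theorem mem_types_iff (hn : 6 ≤ n) (hw : w ∈ perms n) :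
    w ∈ type1 n ∪ type2 n ∪ type3 n ∪ type4 n ∪ type5 n ↔
      TypeShape n (w.idxOf n) (w.idxOf (n - 1)) (w.idxOf (n - 2)) (w.idxOf (n - 3))
        (w.idxOf (n - 4)) (w.idxOf 1) (w.idxOf 2) (w.idxOf 3) := by
  simp only [Set.mem_union, mem_type1_iff hw, mem_type2_iff hn hw, mem_type3_iff hn hw,
    mem_type4_iff hn hw, mem_type5_iff hn hw, TypeShape, or_assoc]

/-- The shapes found from the inversions at `1`, `2` and `3` are those of the five types. -/
theorem mem_exactly_iff_typeShape (hn : 6 ≤ n) (hw : w ∈ perms n) :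
    w ∈ exactly n (n - 3) ↔
      TypeShape n (w.idxOf n) (w.idxOf (n - 1)) (w.idxOf (n - 2)) (w.idxOf (n - 3))
        (w.idxOf (n - 4)) (w.idxOf 1) (w.idxOf 2) (w.idxOf 3) := by
  have hnd := nodup_of_mem_perms hw
  have hmem : ∀ a, 1 ≤ a → a ≤ n → a ∈ w := fun a h h' => (mem_iff_of_mem_perms hw).2 ⟨h, h'⟩
  have hf := isPlacement_idxOf hw
  have h2 : w.filter (2 ≤ ·) = w.filter (· ≠ 1) := by
    rw [filter_succ_le w 1, filter_one_le hw]
  have hq : ∀ x, 2 ≤ x → x ≤ n → (w.filter (2 ≤ ·)).idxOf x =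
      if w.idxOf 1 < w.idxOf x then w.idxOf x - 1 else w.idxOf x := by
    intro x h h'
    rw [h2, idxOf_filter_ne hnd (by omega) (hmem 1 le_rfl (by omega)) (hmem x (by omega) h')]
  have hr : ∀ x, 3 ≤ x → x ≤ n → (w.filter (3 ≤ ·)).idxOf x =
      if (w.filter (2 ≤ ·)).idxOf 2 < (w.filter (2 ≤ ·)).idxOf x then
        (w.filter (2 ≤ ·)).idxOf x - 1 else (w.filter (2 ≤ ·)).idxOf x := by
    intro x h h'
    rw [filter_succ_le w 2, idxOf_filter_ne (hnd.filter _) (by omega)]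
    · exact List.mem_filter.2 ⟨hmem 2 (by omega) (by omega), by simp⟩
    · exact List.mem_filter.2 ⟨hmem x (by omega) h', by simpa using (by omega : 2 ≤ x)⟩
  have hr' : ∀ x, 3 ≤ x → x ≤ n → (w.filter (3 ≤ ·)).idxOf x =
      w.idxOf x - (if w.idxOf 1 < w.idxOf x then 1 else 0) -
        if w.idxOf 2 < w.idxOf x then 1 else 0 := by
    intro x h h'
    rw [hr x h h', hq x (by omega) h', hq 2 le_rfl (by omega)]
    have h1 := hf.ne 1 2
    have h2 := hf.ne 1 x
    have h3 := hf.ne 2 x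
    split_ifs <;> omega
  have hr₀ : (w.filter (3 ≤ ·)).idxOf n = if w.idxOf 2 < w.idxOf n then
      (w.filter (2 ≤ ·)).idxOf n - 1 else (w.filter (2 ≤ ·)).idxOf n := by
    rw [hr n (by omega) le_rfl, hq n (by omega) le_rfl, hq 2 le_rfl (by omega)]
    have h1 := hf.ne 1 2
    have h2 := hf.ne 1 n
    have h3 := hf.ne 2 n
    split_ifs <;> omega
  rw [mem_exactly_iff_shape hn hw]
  exact lateShape_and_not_laterShape_iff hn (hf.lt _) (hf.lt _) (hf.lt _) (hf.lt _) (hf.lt _)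
    (hf.lt _) (hf.lt _) (hf.lt _) (hf.ne _ _) (hf.ne _ _) (hf.ne _ _) (hf.ne _ _) (hf.ne _ _)
    (hf.ne _ _) (hf.ne _ _) (hf.ne _ _) (hf.ne _ _) (hf.ne _ _) (hf.ne _ _) (hf.ne _ _) (hf.ne _ _)
    (hf.ne _ _) (hf.ne _ _) (hf.ne _ _) (hf.ne _ _) (hf.ne _ _) (hf.ne _ _) (hf.ne _ _) (hf.ne _ _)
    (hf.ne _ _) (hf.ne _ _) (hq _ (by omega) (by omega)) (hq _ (by omega) (by omega))
    (hq _ (by omega) (by omega)) (hq _ (by omega) (by omega)) hr₀ (hr' _ (by omega) (by omega))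

end Types

/-! ### Counting permutations with conditions on places -/

/-- The word of length `n` in which the letter `x + 1` stands at the place `σ x`, counted
from `0`. -/
def wordOf {n : ℕ} (σ : Equiv.Perm (Fin n)) : List ℕ :=
  List.ofFn fun i => (σ.symm i : ℕ) + 1

theorem wordOf_mem_perms {n : ℕ} (σ : Equiv.Perm (Fin n)) : wordOf σ ∈ perms n := by
  have h : idWord n = List.ofFn fun i : Fin n => (i : ℕ) + 1 := by
    refine List.ext_getElem (by simp [idWord]) fun i h₁ h₂ => ?_
    simp [idWord, add_comm]
  change (wordOf σ).Perm (idWord n)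
  rw [h]
  exact Equiv.Perm.ofFn_comp_perm σ.symm fun i : Fin n => (i : ℕ) + 1

theorem idxOf_wordOf {n : ℕ} (σ : Equiv.Perm (Fin n)) (x : Fin n) :
    (wordOf σ).idxOf (x + 1 : ℕ) = σ x := by
  have hlt : (σ x : ℕ) < (wordOf σ).length := by simp [wordOf]
  rw [idxOf_eq_iff_getElem (nodup_of_mem_perms (wordOf_mem_perms σ)) hlt]
  simp [wordOf]

theorem wordOf_injective {n : ℕ} : Function.Injective (wordOf (n := n)) := by
  intro σ τ h
  ext x
  rw [← idxOf_wordOf, h, idxOf_wordOf]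

theorem exists_wordOf_eq {n : ℕ} {w : List ℕ} (hw : w ∈ perms n) : ∃ σ, wordOf (n := n) σ = w := by
  have hlen := length_of_mem_perms hw
  have hnd := nodup_of_mem_perms hw
  have hmem : ∀ x : Fin n, (x + 1 : ℕ) ∈ w := fun x =>
    (mem_iff_of_mem_perms hw).2 ⟨by omega, by omega⟩
  have hlt : ∀ x : Fin n, w.idxOf (x + 1 : ℕ) < n := fun x => by
    simpa only [hlen] using List.idxOf_lt_length_of_mem (hmem x)
  have hinj : Function.Injective fun x : Fin n => (⟨w.idxOf (x + 1 : ℕ), hlt x⟩ : Fin n) := by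
    intro x y h
    have h' : (x + 1 : ℕ) = y + 1 := (List.idxOf_inj (hmem x)).1 (Fin.ext_iff.1 h)
    exact Fin.ext (by omega)
  refine ⟨Equiv.ofBijective _ (Finite.injective_iff_bijective.1 hinj), ?_⟩
  generalize hσ : Equiv.ofBijective _ (Finite.injective_iff_bijective.1 hinj) = σ
  refine List.ext_getElem (by simp [wordOf, hlen]) fun i h₁ h₂ => ?_
  obtain ⟨x, hx⟩ := σ.surjective ⟨i, by omega⟩
  have h : (wordOf σ)[i] = (x + 1 : ℕ) := by
    rw [← idxOf_eq_iff_getElem (nodup_of_mem_perms (wordOf_mem_perms σ)), idxOf_wordOf, hx]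
  rw [h, eq_comm, ← idxOf_eq_iff_getElem hnd]
  have : ((σ x : Fin n) : ℕ) = i := by rw [hx]
  rw [← this, ← hσ]
  rfl

section Count

open Equiv

variable {α ι : Type*}

/-- The permutations with `k` prescribed values. -/
theorem card_perm_apply_eq [Fintype α] [Fintype ι] {u v : ι → α} (hu : Function.Injective u)
    (hv : Function.Injective v) :
    Nat.card {σ : Perm α // ∀ i, σ (u i) = v i} =
      (Fintype.card α - Fintype.card ι).factorial := by
  classical
  -- one such permutation `τ` reduces the count to the permutations that fix the points `u i`
  obtain ⟨τ, hτ⟩ : ∃ τ : Perm α, ∀ i, τ (u i) = v i := by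
    let e : {x // x ∈ Set.range u} ≃ {x // x ∈ Set.range v} :=
      (Equiv.ofInjective u hu).symm.trans (Equiv.ofInjective v hv)
    refine ⟨e.extendSubtype, fun i => ?_⟩
    rw [Equiv.extendSubtype_apply_of_mem e (u i) ⟨i, rfl⟩]
    simp only [e, Equiv.trans_apply]
    rw [show (⟨u i, ⟨i, rfl⟩⟩ : Set.range u) = Equiv.ofInjective u hu i from rfl,
      Equiv.symm_apply_apply]
    rfl
  have e₁ : {σ : Perm α // ∀ i, σ (u i) = v i} ≃
      {σ : Perm α // ∀ a, ¬ a ∉ Set.range u → σ a = a} :=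
    (Equiv.mulLeft τ⁻¹).subtypeEquiv fun σ => by
      simp only [not_not, Set.forall_mem_range, Equiv.coe_mulLeft, Perm.mul_apply,
        Perm.inv_eq_iff_eq, hτ]
  rw [Nat.card_congr e₁, ← Nat.card_congr (Perm.subtypeEquivSubtypePerm (· ∉ Set.range u)),
    Nat.card_eq_fintype_card, Fintype.card_perm, Fintype.card_subtype_compl]
  congr 2
  exact (Fintype.card_congr (Equiv.ofInjective u hu)).symm

theorem existsUnique_strictMono_comp [LinearOrder α] {t : ℕ} {f : Fin t → α}
    (hf : Function.Injective f) : ∃! τ : Perm (Fin t), StrictMono (f ∘ τ) := by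
  refine ⟨Tuple.sort f, (Tuple.monotone_sort f).strictMono_of_injective
    (hf.comp (Tuple.sort f).injective), fun τ hτ => ?_⟩
  have h := Tuple.unique_monotone hτ.monotone (Tuple.monotone_sort f)
  exact Equiv.ext fun i => hf (congrFun h i)

/-- All relative orders of the values at the points `v i`, none of which is a point `u i` where the
value is prescribed, are equally frequent. -/
theorem card_perm_apply_eq_strictMono [Finite α] [LinearOrder α] {t : ℕ} {u w : ι → α}
    {v : Fin t → α} (hv : Function.Injective v) (huv : ∀ i j, u i ≠ v j) :
    Nat.card {σ : Perm α // (∀ i, σ (u i) = w i) ∧ StrictMono (σ ∘ v)} * t.factorial =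
      Nat.card {σ : Perm α // ∀ i, σ (u i) = w i} := by
  let ext : Perm (Fin t) → Perm α := fun τ => τ.viaEmbedding ⟨v, hv⟩
  have hext : ∀ τ i, ext τ (v i) = v (τ i) := fun τ i => τ.viaEmbedding_apply ⟨v, hv⟩ i
  have hext' : ∀ τ i, ext τ (u i) = u i := fun τ i =>
    τ.viaEmbedding_apply_of_notMem ⟨v, hv⟩ _ (by rintro ⟨j, hj⟩; exact huv i j hj.symm)
  choose s hs hs' using fun σ : Perm α =>
    existsUnique_strictMono_comp (σ.injective.comp hv)
  -- a permutation of `Fin t` rearranges the values at the points `v i`, and sorting undoes it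
  have e : {σ : Perm α // (∀ i, σ (u i) = w i) ∧ StrictMono (σ ∘ v)} × Perm (Fin t) ≃
      {σ : Perm α // ∀ i, σ (u i) = w i} :=
    { toFun := fun x => ⟨x.1 * (ext x.2)⁻¹, fun i => by
        rw [Perm.mul_apply, Perm.inv_eq_iff_eq.2 (hext' x.2 i).symm]
        exact x.1.2.1 i⟩
      invFun := fun σ => ⟨⟨σ * ext (s σ), fun i => by
          rw [Perm.mul_apply, hext']
          exact σ.2 i, by
          convert hs σ using 1
          ext i
          simp [hext]⟩, s σ⟩
      left_inv := by
        rintro ⟨⟨σ, h₁, h₂⟩, τ⟩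
        have h : s (σ * (ext τ)⁻¹) = τ := by
          refine (hs' _ τ ?_).symm
          convert h₂ using 1
          ext i
          simp [← hext]
        simp only [h, inv_mul_cancel_right]
      right_inv := fun σ => by
        simp }
  rw [← Nat.card_congr e, Nat.card_prod, Nat.card_eq_fintype_card (α := Perm (Fin t)),
    Fintype.card_perm, Fintype.card_fin]

end Count

/-- The number of permutations of `{1, …, n}` such that the map from letters to their places,
counted from `0`, satisfies `P`. -/
noncomputable def count (n : ℕ) (P : (ℕ → ℕ) → Prop) : ℕ :=
  {w | w ∈ perms n ∧ P w.idxOf}.ncard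

theorem finite_perms (n : ℕ) : (perms n).Finite := by
  refine Set.Finite.subset (Set.finite_range (wordOf (n := n))) fun w hw => exists_wordOf_eq hw

section Count

variable {n : ℕ} {P Q : (ℕ → ℕ) → Prop}

theorem count_congr (h : ∀ f, IsPlacement n f → (P f ↔ Q f)) : count n P = count n Q := by
  unfold count
  congr 1
  ext w
  exact and_congr_right fun hw => h _ (isPlacement_idxOf hw)

theorem count_or (h : ∀ f, IsPlacement n f → P f → ¬ Q f) :
    count n (fun f => P f ∨ Q f) = count n P + count n Q := by
  have hf : ∀ R : (ℕ → ℕ) → Prop, {w | w ∈ perms n ∧ R w.idxOf}.Finite := fun R =>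
    (finite_perms n).subset fun w hw => hw.1
  unfold count
  rw [← Set.ncard_union_eq _ (hf P) (hf Q)]
  · congr 1
    ext w
    exact and_or_left
  · rw [Set.disjoint_left]
    exact fun w hP hQ => h _ (isPlacement_idxOf hP.1) hP.2 hQ.2

theorem count_and_not : (count n (fun f => P f ∧ ¬ Q f) : ℚ) =
    count n P - count n (fun f => P f ∧ Q f) := by
  rw [eq_sub_iff_add_eq, ← Nat.cast_add, ← count_or fun f _ h h' => h.2 h'.2]
  refine congrArg _ (count_congr fun f _ => ?_)
  tauto

/-- The permutations with prescribed places of the letters in `l` and a prescribed order of the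
places of the letters in `v`. -/
theorem count_eq_of_iff (l : List (ℕ × ℕ)) (v : List ℕ)
    (hP : ∀ f, IsPlacement n f →
      (P f ↔ (∀ p ∈ l, f p.1 = p.2) ∧ v.Pairwise fun x y => f x < f y))
    (hl : ∀ x ∈ l.map Prod.fst ++ v, 1 ≤ x ∧ x ≤ n) (hnd : (l.map Prod.fst ++ v).Nodup)
    (hl' : ∀ i ∈ l.map Prod.snd, i < n) (hnd' : (l.map Prod.snd).Nodup) :
    (count n P : ℚ) = (n - l.length).factorial / v.length.factorial := by
  have bl : ∀ i : Fin l.length, 1 ≤ l[i].1 ∧ l[i].1 ≤ n := fun i =>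
    hl _ (List.mem_append_left _ (List.mem_map_of_mem (List.getElem_mem i.2)))
  have bl' : ∀ i : Fin l.length, l[i].2 < n := fun i =>
    hl' _ (List.mem_map_of_mem (List.getElem_mem i.2))
  have bv : ∀ i : Fin v.length, 1 ≤ v[i] ∧ v[i] ≤ n := fun i =>
    hl _ (List.mem_append_right _ (List.getElem_mem i.2))
  let a : Fin l.length → Fin n := fun i => ⟨l[i].1 - 1, by have := bl i; omega⟩
  let b : Fin l.length → Fin n := fun i => ⟨l[i].2, bl' i⟩
  let c : Fin v.length → Fin n := fun i => ⟨v[i] - 1, by have := bv i; omega⟩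
  have ha' : ∀ i, (a i : ℕ) + 1 = l[i].1 := fun i => Nat.sub_add_cancel (bl i).1
  have hc' : ∀ i, (c i : ℕ) + 1 = v[i] := fun i => Nat.sub_add_cancel (bv i).1
  rw [List.nodup_append] at hnd
  obtain ⟨hnd₁, hnd₂, hnd₃⟩ := hnd
  have ha : Function.Injective a := by
    intro i j h
    have h' : l[i].1 = l[j].1 := by rw [← ha', ← ha', h]
    refine Fin.ext ((List.Nodup.getElem_inj_iff hnd₁ (hi := by simp) (hj := by simp)).1 ?_)
    simpa using h'
  have hb : Function.Injective b := by
    intro i j h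
    have h' : l[i].2 = l[j].2 := Fin.ext_iff.1 h
    refine Fin.ext ((List.Nodup.getElem_inj_iff hnd' (hi := by simp) (hj := by simp)).1 ?_)
    simpa using h'
  have hc : Function.Injective c := by
    intro i j h
    have h' : v[i] = v[j] := by rw [← hc', ← hc', h]
    exact Fin.ext ((List.Nodup.getElem_inj_iff hnd₂ (hi := i.2) (hj := j.2)).1 h')
  have hac : ∀ i j, a i ≠ c j := by
    intro i j h
    refine hnd₃ l[i].1 (List.mem_map_of_mem (List.getElem_mem i.2)) v[j]
      (List.getElem_mem j.2) ?_
    rw [← ha', ← hc', h]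
  have key : ∀ σ : Equiv.Perm (Fin n), P (wordOf σ).idxOf ↔
      (∀ i, σ (a i) = b i) ∧ StrictMono (σ ∘ c) := by
    intro σ
    rw [hP _ (isPlacement_idxOf (wordOf_mem_perms σ)), List.pairwise_iff_getElem]
    refine and_congr ?_ ?_
    · rw [List.forall_mem_iff_getElem]
      constructor
      · intro h i
        have := h i i.2
        rw [← Fin.getElem_fin, ← ha', idxOf_wordOf] at this
        exact Fin.ext this
      · intro h i hi
        have := Fin.ext_iff.1 (h ⟨i, hi⟩)
        rw [← idxOf_wordOf, ha'] at this
        exact this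
    · constructor
      · intro h i j hij
        have := h i j i.2 j.2 hij
        rw [← Fin.getElem_fin, ← Fin.getElem_fin, ← hc', ← hc', idxOf_wordOf, idxOf_wordOf] at this
        exact this
      · intro h i j hi hj hij
        have : (σ (c ⟨i, hi⟩) : ℕ) < σ (c ⟨j, hj⟩) := h (show (⟨i, hi⟩ : Fin _) < ⟨j, hj⟩ from hij)
        rw [← idxOf_wordOf, ← idxOf_wordOf, hc', hc'] at this
        exact this
  have hcount : count n P =
      Nat.card {σ : Equiv.Perm (Fin n) // (∀ i, σ (a i) = b i) ∧ StrictMono (σ ∘ c)} := by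
    have himage : {w | w ∈ perms n ∧ P w.idxOf} =
        wordOf '' {σ : Equiv.Perm (Fin n) | (∀ i, σ (a i) = b i) ∧ StrictMono (σ ∘ c)} := by
      ext w
      constructor
      · rintro ⟨hw, h⟩
        obtain ⟨σ, rfl⟩ := exists_wordOf_eq hw
        exact ⟨σ, (key σ).1 h, rfl⟩
      · rintro ⟨σ, h, rfl⟩
        exact ⟨wordOf_mem_perms σ, (key σ).2 h⟩
    rw [count, himage, Set.ncard_image_of_injective _ wordOf_injective]
    rfl
  rw [hcount, eq_div_iff (by positivity)]
  have h := card_perm_apply_eq_strictMono (w := b) hc hac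
  rw [card_perm_apply_eq ha hb, Fintype.card_fin, Fintype.card_fin] at h
  exact_mod_cast h

end Count

/-! ### The sizes of the five types -/

section TypeCounts

variable {n : ℕ}

/-- The count for each form prescribes some places and at most one order. Whatever else the form
demands follows from the other letters being elsewhere. -/
theorem count_typeOneShape (hn : 6 ≤ n) :
    (count n fun f => TypeOneShape n (f n) (f (n - 1)) (f (n - 2)) (f (n - 3)) (f 1) (f 2) : ℚ) =
      3 * (n - 3).factorial + (n - 3).factorial / 2 + (n - 4).factorial := by
  have ha : (count n fun f => f n + 1 = n ∧ f (n - 1) + 3 = n ∧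
      f 2 + 2 = n : ℚ) = (n - 3).factorial := by
    rw [count_eq_of_iff [(n, n - 1), (n - 1, n - 3), (2, n - 2)] []]
    · simp
    all_goals simp
    all_goals omega
  have hb : (count n fun f => f n + 1 = n ∧ f (n - 1) + 4 = n ∧
      f 1 + 2 = n : ℚ) = (n - 3).factorial := by
    rw [count_eq_of_iff [(n, n - 1), (n - 1, n - 4), (1, n - 2)] []]
    · simp
    all_goals simp
    all_goals omega
  have hc : (count n fun f => f n + 1 = n ∧ f (n - 1) + 4 = n ∧
      f 1 + 3 = n : ℚ) = (n - 3).factorial := by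
    rw [count_eq_of_iff [(n, n - 1), (n - 1, n - 4), (1, n - 3)] []]
    · simp
    all_goals simp
    all_goals omega
  have hd : (count n fun f => f n + 1 = n ∧ f (n - 1) < f (n - 3) ∧ f (n - 3) < f (n - 2) ∧
      f (n - 2) + 3 = n ∧ f 1 + 2 = n : ℚ) = (n - 3).factorial / 2 := by
    rw [count_eq_of_iff [(n, n - 1), (n - 2, n - 3), (1, n - 2)] [n - 1, n - 3]]
    · simp
    · intro f hf
      have b₃ := hf.lt (n - 3)
      have d₀₃ := hf.ne n (n - 3)
      have d₂₃ := hf.ne (n - 2) (n - 3)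
      have f₃₁ := hf.ne (n - 3) 1
      simp
      omega
    all_goals simp
    all_goals omega
  have he : (count n fun f => f n + 1 = n ∧ f (n - 2) + 4 = n ∧ f 1 + 3 = n ∧
      f (n - 1) + 2 = n : ℚ) = (n - 4).factorial := by
    rw [count_eq_of_iff [(n, n - 1), (n - 2, n - 4), (1, n - 3), (n - 1, n - 2)] []]
    · simp
    all_goals simp
    all_goals omega
  simp only [TypeOneShape, and_or_left]
  rw [count_or, count_or, count_or, count_or]
  · push_cast
    rw [ha, hb, hc, hd, he]
    ring
  all_goals
    intro f hf
    have f₂₁ := hf.ne (n - 2) 1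
    have e₁₂ := hf.ne 1 2
    omega

theorem count_typeTwoShape (hn : 6 ≤ n) :
    (count n fun f => TypeTwoShape n (f n) (f (n - 1)) (f (n - 2)) (f 1) (f 2) (f 3) : ℚ) =
      (n - 2).factorial + (n - 3).factorial - (n - 4).factorial := by
  have ha : (count n fun f => f n + 2 = n ∧ f 3 + 1 = n : ℚ) = (n - 2).factorial := by
    rw [count_eq_of_iff [(n, n - 2), (3, n - 1)] []]
    · simp
    all_goals simp
    all_goals omega
  have hb : (count n fun f => f n + 2 = n ∧ f (n - 1) + 4 = n ∧
      f 1 + 3 = n : ℚ) = (n - 3).factorial := by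
    rw [count_eq_of_iff [(n, n - 2), (n - 1, n - 4), (1, n - 3)] []]
    · simp
    all_goals simp
    all_goals omega
  have hb₂ : (count n fun f => (f n + 2 = n ∧ f (n - 1) + 4 = n ∧ f 1 + 3 = n) ∧
      f 2 + 1 = n : ℚ) = (n - 4).factorial := by
    rw [count_eq_of_iff [(n, n - 2), (n - 1, n - 4), (1, n - 3), (2, n - 1)] []]
    · simp
    all_goals simp
    all_goals omega
  have hb₃ : (count n fun f => (f n + 2 = n ∧ f (n - 1) + 4 = n ∧ f 1 + 3 = n) ∧
      f 3 + 1 = n : ℚ) = (n - 4).factorial := by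
    rw [count_eq_of_iff [(n, n - 2), (n - 1, n - 4), (1, n - 3), (3, n - 1)] []]
    · simp
    all_goals simp
    all_goals omega
  have hc : (count n fun f => f n + 2 = n ∧ f (n - 2) + 4 = n ∧ f 1 + 3 = n ∧
      f (n - 1) + 1 = n : ℚ) = (n - 4).factorial := by
    rw [count_eq_of_iff [(n, n - 2), (n - 2, n - 4), (1, n - 3), (n - 1, n - 1)] []]
    · simp
    all_goals simp
    all_goals omega
  have hb' : (count n fun f => f n + 2 = n ∧ f (n - 1) + 4 = n ∧ f 1 + 3 = n ∧ f 2 + 1 ≠ n ∧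
      f 3 + 1 ≠ n : ℚ) = (n - 3).factorial - 2 * (n - 4).factorial := by
    rw [count_congr (Q := fun f => (f n + 2 = n ∧ f (n - 1) + 4 = n ∧ f 1 + 3 = n) ∧
      ¬ (f 2 + 1 = n ∨ f 3 + 1 = n)) fun f _ => by tauto, count_and_not]
    simp only [and_or_left (c := _ + 1 = n)]
    rw [count_or, hb]
    · push_cast
      rw [hb₂, hb₃]
      ring
    · intro f hf
      have e₂₃ := hf.ne 2 3
      omega
  simp only [TypeTwoShape, and_or_left]
  rw [count_or, count_or]
  · push_cast
    rw [ha, hb', hc]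
    ring
  all_goals
    intro f hf
    have f₁₃ := hf.ne (n - 1) 3
    omega

theorem count_typeThreeShape (hn : 6 ≤ n) :
    (count n fun f => TypeThreeShape n (f n) (f 1) (f 2) : ℚ) =
      2 * ((n - 2).factorial - (n - 3).factorial) := by
  have ha : (count n fun f => f n + 3 = n ∧ f 2 + 2 = n : ℚ) = (n - 2).factorial := by
    rw [count_eq_of_iff [(n, n - 3), (2, n - 2)] []]
    · simp
    all_goals simp
    all_goals omega
  have ha' : (count n fun f => (f n + 3 = n ∧ f 2 + 2 = n) ∧
      f 1 + 1 = n : ℚ) = (n - 3).factorial := by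
    rw [count_eq_of_iff [(n, n - 3), (2, n - 2), (1, n - 1)] []]
    · simp
    all_goals simp
    all_goals omega
  have hb : (count n fun f => f n + 3 = n ∧ f 2 + 1 = n : ℚ) = (n - 2).factorial := by
    rw [count_eq_of_iff [(n, n - 3), (2, n - 1)] []]
    · simp
    all_goals simp
    all_goals omega
  have hb' : (count n fun f => (f n + 3 = n ∧ f 2 + 1 = n) ∧
      f 1 + 2 = n : ℚ) = (n - 3).factorial := by
    rw [count_eq_of_iff [(n, n - 3), (2, n - 1), (1, n - 2)] []]
    · simp
    all_goals simp
    all_goals omega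
  simp only [TypeThreeShape, and_or_left, ← and_assoc]
  rw [count_or]
  · push_cast
    rw [count_and_not, count_and_not, ha, ha', hb, hb']
    ring
  · intro f hf
    omega

theorem count_typeFourShape (hn : 6 ≤ n) :
    (count n fun f => TypeFourShape n (f n) (f (n - 1)) (f (n - 2)) (f 1) (f 2) : ℚ) =
      3 * (n - 2).factorial := by
  have ha : (count n fun f => f n + 4 = n ∧ f 1 + 1 = n : ℚ) = (n - 2).factorial := by
    rw [count_eq_of_iff [(n, n - 4), (1, n - 1)] []]
    · simp
    all_goals simp
    all_goals omega
  have ha' : (count n fun f => (f n + 4 = n ∧ f 1 + 1 = n) ∧ f (n - 2) + 3 = n ∧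
      f (n - 1) + 2 = n : ℚ) = (n - 4).factorial := by
    rw [count_eq_of_iff [(n, n - 4), (1, n - 1), (n - 2, n - 3), (n - 1, n - 2)] []]
    · simp
    all_goals simp
    all_goals omega
  have hb : (count n fun f => f n + 4 = n ∧ f 1 + 2 = n : ℚ) = (n - 2).factorial := by
    rw [count_eq_of_iff [(n, n - 4), (1, n - 2)] []]
    · simp
    all_goals simp
    all_goals omega
  have hc : (count n fun f => f n + 4 = n ∧ f 1 + 3 = n : ℚ) = (n - 2).factorial := by
    rw [count_eq_of_iff [(n, n - 4), (1, n - 3)] []]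
    · simp
    all_goals simp
    all_goals omega
  have hd : (count n fun f => f n + 4 = n ∧ f (n - 2) + 3 = n ∧ f (n - 1) + 2 = n ∧
      f 2 + 1 = n : ℚ) = (n - 4).factorial := by
    rw [count_eq_of_iff [(n, n - 4), (n - 2, n - 3), (n - 1, n - 2), (2, n - 1)] []]
    · simp
    all_goals simp
    all_goals omega
  have ha'' : (count n fun f => f n + 4 = n ∧ f 1 + 1 = n ∧ ¬ (f (n - 2) + 3 = n ∧
      f (n - 1) + 2 = n) : ℚ) = (n - 2).factorial - (n - 4).factorial := by
    have h := count_and_not (n := n) (P := fun f => f n + 4 = n ∧ f 1 + 1 = n)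
      (Q := fun f => f (n - 2) + 3 = n ∧ f (n - 1) + 2 = n)
    rw [ha, ha'] at h
    simpa only [and_assoc] using h
  simp only [TypeFourShape, and_or_left]
  rw [count_or, count_or, count_or]
  · push_cast
    rw [ha'', hb, hc, hd]
    ring
  all_goals
    intro f hf
    have f₁₁ := hf.ne (n - 1) 1
    have f₂₁ := hf.ne (n - 2) 1
    have e₁₂ := hf.ne 1 2
    omega

theorem count_typeFiveShape (hn : 6 ≤ n) :
    (count n fun f => TypeFiveShape n (f n) (f (n - 1)) (f (n - 2)) (f (n - 3)) (f (n - 4))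
      (f 1) (f 2) : ℚ) =
      3 * (n - 2).factorial / 2 - (n - 4).factorial + 3 * ((n - 3).factorial / 2) +
        (n - 2).factorial / 6 + 4 * ((n - 2).factorial / 24) - 2 * (n - 3).factorial := by
  have ha : (count n fun f => f n < f (n - 2) ∧ f (n - 1) + 2 = n ∧
      f 2 + 1 = n : ℚ) = (n - 2).factorial / 2 := by
    rw [count_eq_of_iff [(n - 1, n - 2), (2, n - 1)] [n, n - 2]]
    · simp
    all_goals simp
    all_goals omega
  have ha' : (count n fun f => (f n < f (n - 2) ∧ f (n - 1) + 2 = n ∧ f 2 + 1 = n) ∧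
      f n + 4 = n : ℚ) = (n - 4).factorial := by
    rw [count_eq_of_iff [(n - 1, n - 2), (2, n - 1), (n, n - 4), (n - 2, n - 3)] []]
    · simp
    · intro f hf
      have b₂ := hf.lt (n - 2)
      have d₀₂ := hf.ne n (n - 2)
      have d₁₂ := hf.ne (n - 1) (n - 2)
      have f₂₂ := hf.ne (n - 2) 2
      simp
      omega
    all_goals simp
    all_goals omega
  have hb : (count n fun f => f n + 4 < n ∧ f n < f (n - 3) ∧ f (n - 3) < f (n - 1) ∧
      f (n - 1) + 3 = n ∧ f (n - 2) + 2 = n ∧ f 1 + 1 = n : ℚ) = (n - 3).factorial / 2 := by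
    rw [count_eq_of_iff [(n - 1, n - 3), (n - 2, n - 2), (1, n - 1)] [n, n - 3]]
    · simp
    · intro f hf
      have b₃ := hf.lt (n - 3)
      have d₁₃ := hf.ne (n - 1) (n - 3)
      have d₂₃ := hf.ne (n - 2) (n - 3)
      have f₃₁ := hf.ne (n - 3) 1
      simp
      omega
    all_goals simp
    all_goals omega
  have hc : (count n fun f => f n + 4 < n ∧ f n < f (n - 1) ∧ f (n - 1) < f (n - 3) ∧
      f (n - 3) < f (n - 2) ∧ f (n - 2) + 2 = n ∧ f 1 + 1 = n : ℚ) = (n - 2).factorial / 6 := by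
    rw [count_eq_of_iff [(n - 2, n - 2), (1, n - 1)] [n, n - 1, n - 3]]
    · simp [Nat.factorial]
    · intro f hf
      have b₃ := hf.lt (n - 3)
      have d₂₃ := hf.ne (n - 2) (n - 3)
      have f₃₁ := hf.ne (n - 3) 1
      simp
      omega
    all_goals simp
    all_goals omega
  have hd₁ : (count n fun f => f n + 4 < n ∧ f (n - 1) < f n ∧ f n < f (n - 3) ∧
      f (n - 3) < f (n - 4) ∧ f (n - 4) < f (n - 2) ∧ f (n - 2) + 2 = n ∧
      f 1 + 1 = n : ℚ) = (n - 2).factorial / 24 := by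
    rw [count_eq_of_iff [(n - 2, n - 2), (1, n - 1)] [n - 1, n, n - 3, n - 4]]
    · simp [Nat.factorial]
    · intro f hf
      have b₄ := hf.lt (n - 4)
      have d₂₄ := hf.ne (n - 2) (n - 4)
      have f₄₁ := hf.ne (n - 4) 1
      simp
      omega
    all_goals simp
    all_goals omega
  have hd₂ : (count n fun f => f n + 4 < n ∧ f (n - 1) < f n ∧ f n < f (n - 4) ∧
      f (n - 4) < f (n - 3) ∧ f (n - 3) < f (n - 2) ∧ f (n - 2) + 2 = n ∧
      f 1 + 1 = n : ℚ) = (n - 2).factorial / 24 := by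
    rw [count_eq_of_iff [(n - 2, n - 2), (1, n - 1)] [n - 1, n, n - 4, n - 3]]
    · simp [Nat.factorial]
    · intro f hf
      have b₃ := hf.lt (n - 3)
      have d₂₃ := hf.ne (n - 2) (n - 3)
      have f₃₁ := hf.ne (n - 3) 1
      simp
      omega
    all_goals simp
    all_goals omega
  have he₁ : (count n fun f => f n < f (n - 2) ∧ f (n - 1) + 3 = n ∧
      f 1 + 2 = n : ℚ) = (n - 2).factorial / 2 := by
    rw [count_eq_of_iff [(n - 1, n - 3), (1, n - 2)] [n, n - 2]]
    · simp
    all_goals simp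
    all_goals omega
  have he₁' : (count n fun f => (f n < f (n - 2) ∧ f (n - 1) + 3 = n ∧ f 1 + 2 = n) ∧
      f (n - 2) + 1 = n : ℚ) = (n - 3).factorial := by
    rw [count_eq_of_iff [(n - 1, n - 3), (1, n - 2), (n - 2, n - 1)] []]
    · simp
    · intro f hf
      have b₀ := hf.lt n
      have f₀₁ := hf.ne n 1
      have d₀₂ := hf.ne n (n - 2)
      simp
      omega
    all_goals simp
    all_goals omega
  have he₂ : (count n fun f => f n < f (n - 2) ∧ f (n - 1) + 3 = n ∧
      f 1 + 1 = n : ℚ) = (n - 2).factorial / 2 := by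
    rw [count_eq_of_iff [(n - 1, n - 3), (1, n - 1)] [n, n - 2]]
    · simp
    all_goals simp
    all_goals omega
  have he₂' : (count n fun f => (f n < f (n - 2) ∧ f (n - 1) + 3 = n ∧ f 1 + 1 = n) ∧
      f (n - 2) + 2 = n : ℚ) = (n - 3).factorial := by
    rw [count_eq_of_iff [(n - 1, n - 3), (1, n - 1), (n - 2, n - 2)] []]
    · simp
    · intro f hf
      have b₀ := hf.lt n
      have f₀₁ := hf.ne n 1
      have d₀₂ := hf.ne n (n - 2)
      simp
      omega
    all_goals simp
    all_goals omega
  have hf : (count n fun f => f n + 4 < n ∧ f n < f (n - 3) ∧ f (n - 3) < f (n - 1) ∧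
      f (n - 1) + 3 = n ∧ f 1 + 2 = n ∧ f (n - 2) + 1 = n : ℚ) = (n - 3).factorial / 2 := by
    rw [count_eq_of_iff [(n - 1, n - 3), (1, n - 2), (n - 2, n - 1)] [n, n - 3]]
    · simp
    · intro f hf
      have b₃ := hf.lt (n - 3)
      have d₁₃ := hf.ne (n - 1) (n - 3)
      have d₂₃ := hf.ne (n - 2) (n - 3)
      have f₃₁ := hf.ne (n - 3) 1
      simp
      omega
    all_goals simp
    all_goals omega
  have hg : (count n fun f => f n + 4 < n ∧ f n < f (n - 3) ∧ f (n - 3) < f (n - 2) ∧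
      f (n - 2) + 3 = n ∧ f 1 + 2 = n ∧ f (n - 1) + 1 = n : ℚ) = (n - 3).factorial / 2 := by
    rw [count_eq_of_iff [(n - 2, n - 3), (1, n - 2), (n - 1, n - 1)] [n, n - 3]]
    · simp
    · intro f hf
      have b₃ := hf.lt (n - 3)
      have d₁₃ := hf.ne (n - 1) (n - 3)
      have d₂₃ := hf.ne (n - 2) (n - 3)
      have f₃₁ := hf.ne (n - 3) 1
      simp
      omega
    all_goals simp
    all_goals omega
  have hh₁ : (count n fun f => f n + 4 < n ∧ f (n - 2) < f n ∧ f n < f (n - 3) ∧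
      f (n - 3) < f (n - 4) ∧ f (n - 4) < f (n - 1) ∧ f (n - 1) + 2 = n ∧
      f 1 + 1 = n : ℚ) = (n - 2).factorial / 24 := by
    rw [count_eq_of_iff [(n - 1, n - 2), (1, n - 1)] [n - 2, n, n - 3, n - 4]]
    · simp [Nat.factorial]
    · intro f hf
      have b₄ := hf.lt (n - 4)
      have d₁₄ := hf.ne (n - 1) (n - 4)
      have f₄₁ := hf.ne (n - 4) 1
      simp
      omega
    all_goals simp
    all_goals omega
  have hh₂ : (count n fun f => f n + 4 < n ∧ f (n - 2) < f n ∧ f n < f (n - 4) ∧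
      f (n - 4) < f (n - 3) ∧ f (n - 3) < f (n - 1) ∧ f (n - 1) + 2 = n ∧
      f 1 + 1 = n : ℚ) = (n - 2).factorial / 24 := by
    rw [count_eq_of_iff [(n - 1, n - 2), (1, n - 1)] [n - 2, n, n - 4, n - 3]]
    · simp [Nat.factorial]
    · intro f hf
      have b₃ := hf.lt (n - 3)
      have d₁₃ := hf.ne (n - 1) (n - 3)
      have f₃₁ := hf.ne (n - 3) 1
      simp
      omega
    all_goals simp
    all_goals omega
  -- with these places of `n - 1` and `2`, the words to exclude have `n` at the place `n - 4`
  have ha'' : (count n fun f => f n + 4 < n ∧ f n < f (n - 2) ∧ f (n - 2) < f (n - 1) ∧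
      f (n - 1) + 2 = n ∧ f 2 + 1 = n ∧ ¬ (f (n - 2) = f n + 1 ∧
      f (n - 1) = f (n - 2) + 1) : ℚ) = (n - 2).factorial / 2 - (n - 4).factorial := by
    rw [count_congr (Q := fun f => (f n < f (n - 2) ∧ f (n - 1) + 2 = n ∧ f 2 + 1 = n) ∧
      ¬ f n + 4 = n), count_and_not, ha, ha']
    intro f hf
    have b₂ := hf.lt (n - 2)
    have d₁₂ := hf.ne (n - 1) (n - 2)
    have f₂₂ := hf.ne (n - 2) 2
    omega
  -- `n - 2` comes before `n - 1` unless it is at the one place behind that is not taken by `1`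
  have he₁'' : (count n fun f => f n + 4 < n ∧ f n < f (n - 2) ∧ f (n - 2) < f (n - 1) ∧
      f (n - 1) + 3 = n ∧ f 1 + 2 = n : ℚ) = (n - 2).factorial / 2 - (n - 3).factorial := by
    rw [count_congr (Q := fun f => (f n < f (n - 2) ∧ f (n - 1) + 3 = n ∧ f 1 + 2 = n) ∧
      ¬ f (n - 2) + 1 = n), count_and_not, he₁, he₁']
    intro f hf
    have b₂ := hf.lt (n - 2)
    have d₁₂ := hf.ne (n - 1) (n - 2)
    have f₂₁ := hf.ne (n - 2) 1
    omega
  have he₂'' : (count n fun f => f n + 4 < n ∧ f n < f (n - 2) ∧ f (n - 2) < f (n - 1) ∧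
      f (n - 1) + 3 = n ∧ f 1 + 1 = n : ℚ) = (n - 2).factorial / 2 - (n - 3).factorial := by
    rw [count_congr (Q := fun f => (f n < f (n - 2) ∧ f (n - 1) + 3 = n ∧ f 1 + 1 = n) ∧
      ¬ f (n - 2) + 2 = n), count_and_not, he₂, he₂']
    intro f hf
    have b₂ := hf.lt (n - 2)
    have d₁₂ := hf.ne (n - 1) (n - 2)
    have f₂₁ := hf.ne (n - 2) 1
    omega
  simp only [TypeFiveShape, and_or_left]
  rw [count_or, count_or, count_or, count_or, count_or, count_or, count_or, count_or, count_or,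
    count_or]
  · push_cast
    rw [ha'', hb, hc, hd₁, hd₂, he₁'', he₂'', hf, hg, hh₁, hh₂]
    ring
  all_goals
    intro f hf
    have e₁₂ := hf.ne 1 2
    have d₁₂ := hf.ne (n - 1) (n - 2)
    omega

end TypeCounts

/-- The types differ in the place of `n`. -/
theorem count_typeShape {n : ℕ} (hn : 6 ≤ n) :
    (count n fun f => TypeShape n (f n) (f (n - 1)) (f (n - 2)) (f (n - 3)) (f (n - 4)) (f 1) (f 2)
      (f 3) : ℚ) = (47 * (n : ℚ) ^ 2 - 223 * (n : ℚ) + 240) * (Nat.factorial (n - 4) : ℚ) / 6 := by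
  have h₂ : ((n - 2).factorial : ℚ) = ((n : ℚ) - 2) * ((n : ℚ) - 3) * (n - 4).factorial := by
    obtain ⟨m, rfl⟩ := Nat.exists_eq_add_of_le' (show 4 ≤ n by omega)
    rw [Nat.add_sub_cancel, show m + 4 - 2 = m + 1 + 1 by omega, Nat.factorial_succ,
      Nat.factorial_succ]
    push_cast
    ring
  have h₃ : ((n - 3).factorial : ℚ) = ((n : ℚ) - 3) * (n - 4).factorial := by
    obtain ⟨m, rfl⟩ := Nat.exists_eq_add_of_le' (show 4 ≤ n by omega)
    rw [Nat.add_sub_cancel, show m + 4 - 3 = m + 1 by omega, Nat.factorial_succ]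
    push_cast
    ring
  simp only [TypeShape]
  rw [count_or, count_or, count_or, count_or]
  · push_cast
    rw [count_typeOneShape hn, count_typeTwoShape hn, count_typeThreeShape hn,
      count_typeFourShape hn, count_typeFiveShape hn, h₂, h₃]
    ring
  · intro f _ h h'
    have := h.1
    have := h'.1
    omega
  · rintro f _ h (h' | h')
    all_goals
      have := h.1
      have := h'.1
      omega
  · rintro f _ h (h' | h' | h')
    all_goals
      have := h.1
      have := h'.1
      omega
  · rintro f _ h (h' | h' | h' | h')
    all_goals
      have := h.1
      have := h'.1
      omega

theorem exactly_eq_inter {n : ℕ} (hn : 6 ≤ n) :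
    exactly n (n - 3) = perms n ∩ (type1 n ∪ type2 n ∪ type3 n ∪ type4 n ∪ type5 n) := by
  ext w
  constructor
  · intro h
    exact ⟨h.1, (mem_types_iff hn h.1).2 ((mem_exactly_iff_typeShape hn h.1).1 h)⟩
  · rintro ⟨hw, h⟩
    exact (mem_exactly_iff_typeShape hn hw).2 ((mem_types_iff hn hw).1 h)

theorem ncard_exactly {n : ℕ} (hn : 6 ≤ n) : ((exactly n (n - 3)).ncard : ℚ) =
    (47 * (n : ℚ) ^ 2 - 223 * (n : ℚ) + 240) * (Nat.factorial (n - 4) : ℚ) / 6 := by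
  rw [← count_typeShape hn, count]
  congr 2
  ext w
  constructor
  · intro h
    exact ⟨h.1, (mem_exactly_iff_typeShape hn h.1).1 h⟩
  · rintro ⟨hw, h⟩
    exact (mem_exactly_iff_typeShape hn hw).2 h

theorem choose_form_eq {n : ℕ} (hn : 6 ≤ n) :
    (Nat.factorial (n - 4) : ℚ) / 3 *
        (47 * (Nat.choose (n - 6) 2 : ℚ) + 194 * (Nat.choose (n - 6) 1 : ℚ) + 297) =
      (47 * (n : ℚ) ^ 2 - 223 * (n : ℚ) + 240) * (Nat.factorial (n - 4) : ℚ) / 6 := by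
  rw [Nat.cast_choose_two, Nat.choose_one_right, Nat.cast_sub hn]
  push_cast
  ring

end StackSorting

theorem theorem1 (n : ℕ) (hn : 6 ≤ n) :
    StackSorting.exactly n (n - 3) =
      StackSorting.perms n ∩
        (StackSorting.type1 n ∪ StackSorting.type2 n ∪ StackSorting.type3 n ∪
          StackSorting.type4 n ∪ StackSorting.type5 n) ∧
    ((StackSorting.exactly n (n - 3)).ncard : ℚ) =
      (Nat.factorial (n - 4) : ℚ) / 3 *
        (47 * (Nat.choose (n - 6) 2 : ℚ) + 194 * (Nat.choose (n - 6) 1 : ℚ) + 297) ∧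
    ((StackSorting.exactly n (n - 3)).ncard : ℚ) =
      (47 * (n : ℚ) ^ 2 - 223 * (n : ℚ) + 240) * (Nat.factorial (n - 4) : ℚ) / 6 :=
  ⟨StackSorting.exactly_eq_inter hn,
    (StackSorting.ncard_exactly hn).trans (StackSorting.choose_form_eq hn).symm,
    StackSorting.ncard_exactly hn⟩
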